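/- A two-player win-lose coordination game (WLC-game) consists of two disjoint, finite, non-empty choice sets $C_1,C_2$ and a winning relation $W\subseteq C_1\times C_2$ such that every choice occurs in some pair in $W$. It is an $m$-choice game if $\max\{|C_1|,|C_2|\}=m$. The choice matching game $\mathrm{CM}_m$ ($m\ge 1$) has $|C_1|=|C_2|=m$, and its winning relation consists of $m$ pairwise disjoint pairs. A renaming between games consists of bijections between the choice sets that preserve the winning relation in both directions and that may also exchange the two players. The game is played repeatedly until the players coordinate, that is, until the pair of choices they make in a round lies in $W$. A history is a finite sequence of choice pairs, and a stage is a game together with a history. A renaming between stages is a renaming between the games that maps one history to the other term by term. A protocol assigns to each player and each stage of each game a probability distribution on the choices of that player; in each round the two players draw their choices independently. It is structural if it assigns the same probabilities to choices that correspond to each other under a renaming between stages. The expected coordination time (ECT) of a structural protocol in $G$ is the expected number of rounds until coordination, in $[1,\infty]$, when both players follow the protocol from the empty history. The optimal ECT in $G$ is the minimum of the ECTs in $G$ of all structural protocols. The greatest optimal ECT among a class $\mathcal G$ of games is the value $r$ such that $r$ is the optimal ECT in some $G\in\mathcal G$ and such that for every $G\in\mathcal G$ some structural protocol has ECT at most $r$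 in $G$. **Corollary.** Let $m\ge 1$ with $m\neq 3$. Then the greatest optimal ECT $r$ among all $m$-choice two-player WLC-games exists, and it is uniquely realized by $\mathrm{CM}_m$: an $m$-choice game has optimal ECT $r$ if and only if it equals $\mathrm{CM}_m$ up to renaming. -/

import Mathlib

open scoped ENNReal

noncomputable section

/-- A two-player win-lose coordination game. The two (automatically disjoint) choice sets are given
as two types, so the domain of the game is `C₁ ⊕ C₂`. Every choice lies on a winning profile. -/
structure WLCGame where
  C₁ : Type
  C₂ : Type
  [fintype₁ : Fintype C₁]
  [fintype₂ : Fintype C₂]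
  [nonempty₁ : Nonempty C₁]
  [nonempty₂ : Nonempty C₂]
  /-- the winning relation -/
  W : Set (C₁ × C₂)
  not_losing₁ : ∀ a : C₁, ∃ b : C₂, (a, b) ∈ W
  not_losing₂ : ∀ b : C₂, ∃ a : C₁, (a, b) ∈ W

namespace WLCGame

attribute [instance] fintype₁ fintype₂ nonempty₁ nonempty₂

/-- Choice profiles. -/
abbrev Profile (G : WLCGame) : Type := G.C₁ × G.C₂

/-- A history: the choice profiles played so far, in the order in which they were played.
A stage of a repeated play of `G` is a pair of `G` and a history of `G`. -/
abbrev History (G : WLCGame) : Type := List G.Profile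

/-- `G` is an `m`-choice game: the larger of its two choice sets has `m` elements. -/
def IsChoiceGame (m : ℕ) (G : WLCGame) : Prop :=
  max (Fintype.card G.C₁) (Fintype.card G.C₂) = m

/-- The two-player choice matching game: `m` pairwise disjoint winning profiles. -/
def CM (m : ℕ) [NeZero m] : WLCGame where
  C₁ := Fin m
  C₂ := Fin m
  W := {σ | σ.1 = σ.2}
  not_losing₁ := fun a => ⟨a, rfl⟩
  not_losing₂ := fun b => ⟨b, rfl⟩

/-- A renaming of games that leaves the player roles in place. -/
structure DirectRenaming (G G' : WLCGame) where
  e₁ : G.C₁ ≃ G'.C₁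
  e₂ : G.C₂ ≃ G'.C₂
  win_iff : ∀ a b, (a, b) ∈ G.W ↔ (e₁ a, e₂ b) ∈ G'.W

/-- A renaming of games that exchanges the two player roles. -/
structure SwapRenaming (G G' : WLCGame) where
  e₁ : G.C₁ ≃ G'.C₂
  e₂ : G.C₂ ≃ G'.C₁
  win_iff : ∀ a b, (a, b) ∈ G.W ↔ (e₂ b, e₁ a) ∈ G'.W

/-- The image of a choice profile under a role-preserving renaming. -/
def DirectRenaming.mapProfile {G G' : WLCGame} (e : DirectRenaming G G') (σ : G.Profile) :
    G'.Profile :=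
  (e.e₁ σ.1, e.e₂ σ.2)

/-- The image of a choice profile under a role-exchanging renaming. -/
def SwapRenaming.mapProfile {G G' : WLCGame} (e : SwapRenaming G G') (σ : G.Profile) :
    G'.Profile :=
  (e.e₂ σ.2, e.e₁ σ.1)

/-- `G` and `G'` are the same game up to renaming. -/
def IsRenamingOf (G G' : WLCGame) : Prop :=
  Nonempty (DirectRenaming G G') ∨ Nonempty (SwapRenaming G G')

end WLCGame

/-- A protocol prescribes a mixed strategy to each of the two players in every stage of every
game. -/
structure Protocol where
  first : ∀ G : WLCGame, G.History → PMF G.C₁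
  second : ∀ G : WLCGame, G.History → PMF G.C₂

namespace Protocol

open WLCGame

/-- A protocol is structural if it is indifferent to all renamings between stages. A renaming
from the stage `(G, H)` to the stage `(G', H')` is a renaming of `G` to `G'` that maps the profiles
in `H` one by one to those in `H'`. -/
structure IsStructural (π : Protocol) : Prop where
  direct : ∀ (G G' : WLCGame) (e : DirectRenaming G G') (H : G.History) (H' : G'.History),
    H.map e.mapProfile = H' →
      (∀ a : G.C₁, π.first G H a = π.first G' H' (e.e₁ a)) ∧
      (∀ b : G.C₂, π.second G H b = π.second G' H' (e.e₂ b))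
  swap : ∀ (G G' : WLCGame) (e : SwapRenaming G G') (H : G.History) (H' : G'.History),
    H.map e.mapProfile = H' →
      (∀ a : G.C₁, π.first G H a = π.second G' H' (e.e₁ a)) ∧
      (∀ b : G.C₂, π.second G H b = π.first G' H' (e.e₂ b))

open Classical in
/-- The probability that, from the stage `(G, H)` and with both players following `π` (and drawing
their choices independently), the players fail to coordinate in each of the next `k` rounds and
coordinate in the round after these. -/
def coordProb (π : Protocol) (G : WLCGame) : ℕ → G.History → ℝ≥0∞
  | 0, H => ∑ σ : G.Profile,
      if σ ∈ G.W then π.first G H σ.1 * π.second G H σ.2 else 0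
  | k + 1, H => ∑ σ : G.Profile,
      if σ ∈ G.W then 0
      else π.first G H σ.1 * π.second G H σ.2 * coordProb π G k (H ++ [σ])

/-- The expected coordination time from the stage `(G, H)`: the expected number of rounds until
coordination. An infinite play without coordination counts as infinitely many rounds, and here
`⊤ * 0 = 0`. -/
def ectFrom (π : Protocol) (G : WLCGame) (H : G.History) : ℝ≥0∞ :=
  ∑' k : ℕ, ((k : ℝ≥0∞) + 1) * π.coordProb G k H + ⊤ * (1 - ∑' k : ℕ, π.coordProb G k H)

/-- The expected coordination time in `G`, from the initial stage. -/
def ect (π : Protocol) (G : WLCGame) : ℝ≥0∞ :=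
  π.ectFrom G []

end Protocol

namespace WLCGame

/-- `r` is the optimal expected coordination time in `G`: the minimum over structural protocols. -/
def IsOptimalECT (G : WLCGame) (r : ℝ≥0∞) : Prop :=
  IsLeast {t | ∃ π : Protocol, π.IsStructural ∧ π.ect G = t} r

/-- `r` is the greatest optimal expected coordination time among the games in the class `𝒢`. -/
def IsGreatestOptimalECT (𝒢 : Set WLCGame) (r : ℝ≥0∞) : Prop :=
  (∃ G ∈ 𝒢, G.IsOptimalECT r) ∧
    ∀ G ∈ 𝒢, ∃ π : Protocol, π.IsStructural ∧ π.ect G ≤ r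

end WLCGame

end

open scoped ENNReal

noncomputable section

open WLCGame

/-! The value `r` is `matchingTime m`, which is 3 - 2/m except that it is 7/3 for m = 5. The proof
matches a lower bound for the choice matching game with explicit protocols, then gives every other
game a protocol that is strictly faster.

Lower bound. As long as play in the matching game fails symmetrically, the stage has a symmetry that
exchanges the players: an involution `f` pairing the choices of each past profile (`Mirrors`). A
structural protocol must then give the second player the `f`-image of the first player's
distribution and treat all fixed choices alike. After a losing round, let n be the number of fixed
choices, u the probability of playing one of them, and B the probability of coordinating on moved
choices. Then `mirror_bound` bounds the remaining time below by a quadratic expression in u and B,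
and `residualTime_le_ectFrom` deduces that it is at least 2, except for n = 1 (a single focal
choice, bound 1) and n = 3 (bound 5/3). The first round is uniform, which gives `le_ect_CM`.

Upper bounds. Wait-or-move (uniform first choices, then a fair coin between repeating and replying)
coordinates from the second round on with probability at least 1/2 per round, so its time is at most
3 - 2E/(|C₁||C₂|), where E counts the winning pairs. By `card_mul_card_lt` this is below 3 - 2/m
except for the matching game, where equality holds. For m = 5 the matching game is faster, because
loop avoidance passes through 5, 3, 1 free choices and takes 7/3. Other games with m = 5 must beat
7/3: unequal choice sets let the players break the tie and finish within 2 expected rounds, E ≥ 9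
makes wait-or-move fast enough, and for 6 ≤ E ≤ 8 the distinction between choices of degree one and
of higher degree breaks ties often enough (`hubLeaf_ect_lt`). -/

theorem ENNReal.tsum_survival_eq {s c : ℕ → ℝ≥0∞} (h0 : s 0 = 1)
    (h : ∀ k, s k = c k + s (k + 1)) :
    ∑' k : ℕ, ((k : ℝ≥0∞) + 1) * c k + ⊤ * (1 - ∑' k, c k) = ∑' k, s k := by
  have hpart : ∀ N, ∑ k ∈ Finset.range N, c k + s N = 1 := by
    intro N
    induction N with
    | zero => simp [h0]
    | succ N ih => rw [Finset.sum_range_succ, add_assoc, ← h, ih]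
  have hle : ∑' k, c k ≤ 1 := by
    rw [ENNReal.tsum_eq_iSup_nat]
    exact iSup_le fun N => (hpart N) ▸ le_self_add
  have hfin : ∀ k, c k ≠ ⊤ := fun k =>
    ne_top_of_le_ne_top ENNReal.one_ne_top ((ENNReal.le_tsum k).trans hle)
  -- Survival past `j` splits into later coordination and never coordinating. The constant defect
  -- occurs in every `s j`, so its sum over `j` is the `⊤` term.
  have htail : ∀ j, s j = ∑' i, c (i + j) + (1 - ∑' k, c k) := by
    intro j
    induction j with
    | zero => simp [h0, add_tsub_cancel_of_le hle]
    | succ j ih =>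
      have h1 : ∑' i, c (i + j) = c j + ∑' i, c (i + (j + 1)) := by
        rw [tsum_eq_zero_add' ENNReal.summable]
        simp only [zero_add, add_assoc, add_comm 1 j]
      rw [h j, h1, add_assoc] at ih
      exact (ENNReal.add_right_inj (hfin j)).1 ih
  -- Resummation along antidiagonals: `c n` occurs once for each of the `n + 1` pairs with sum `n`.
  have hdouble : ∑' j, ∑' i, c (i + j) = ∑' k : ℕ, ((k : ℝ≥0∞) + 1) * c k := by
    rw [← ENNReal.tsum_prod (f := fun j i => c (i + j)),
      ← (Finset.HasAntidiagonal.sigmaAntidiagonalEquivProd (A := ℕ)).tsum_eq, ENNReal.tsum_sigma']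
    refine tsum_congr fun n => ?_
    rw [tsum_fintype]
    have : ∀ x : Finset.HasAntidiagonal.antidiagonal n, c (x.1.2 + x.1.1) = c n := fun x => by
      rw [add_comm, Finset.HasAntidiagonal.mem_antidiagonal.1 x.2]
    simp [Finset.HasAntidiagonal.sigmaAntidiagonalEquivProd, this]
  rw [tsum_congr htail, ENNReal.tsum_add, hdouble, ENNReal.tsum_const]
  simp

/-! ### Survival probabilities, the one-step recursion and invariance under renaming -/

namespace PMF

theorem sum_eq_one {α : Type*} [Fintype α] (p : PMF α) : ∑ a, p a = 1 := by
  rw [← tsum_fintype (L := .unconditional α), p.tsum_coe]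

theorem sum_toReal_eq_one {α : Type*} [Fintype α] (p : PMF α) : ∑ a, (p a).toReal = 1 := by
  rw [← ENNReal.toReal_sum fun a _ => p.apply_ne_top a, p.sum_eq_one, ENNReal.toReal_one]

theorem sum_prod_eq_one {α β : Type*} [Fintype α] [Fintype β] (p : PMF α) (q : PMF β) :
    ∑ σ : α × β, p σ.1 * q σ.2 = 1 := by
  rw [Fintype.sum_prod_type]
  simp [← Finset.mul_sum, sum_eq_one]

end PMF

namespace Protocol

open WLCGame

variable (π : Protocol) (G : WLCGame)

/-- The probability that a profile is played in a given stage. -/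
def profileProb (H : G.History) (σ : G.Profile) : ℝ≥0∞ :=
  π.first G H σ.1 * π.second G H σ.2

theorem sum_profileProb (H : G.History) : ∑ σ, π.profileProb G H σ = 1 :=
  PMF.sum_prod_eq_one _ _

open Classical in
/-- The probability of failing to coordinate in each of the next `k` rounds. -/
def survival : ℕ → G.History → ℝ≥0∞
  | 0, _ => 1
  | k + 1, H => ∑ σ : G.Profile,
      if σ ∈ G.W then 0 else π.profileProb G H σ * survival k (H ++ [σ])

theorem survival_eq (k : ℕ) (H : G.History) :
    π.survival G k H = π.coordProb G k H + π.survival G (k + 1) H := by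
  classical
  induction k generalizing H with
  | zero =>
    simp only [survival, coordProb, ← Finset.sum_add_distrib]
    refine (π.sum_profileProb G H).symm.trans (Finset.sum_congr rfl fun σ _ => ?_)
    split_ifs <;> simp [profileProb]
  | succ k ih =>
    rw [survival, survival, coordProb, ← Finset.sum_add_distrib]
    refine Finset.sum_congr rfl fun σ _ => ?_
    split_ifs
    · simp
    · rw [ih, mul_add]; rfl

theorem ectFrom_eq_tsum_survival (H : G.History) :
    π.ectFrom G H = ∑' k, π.survival G k H :=
  ENNReal.tsum_survival_eq (s := fun k => π.survival G k H) rfl fun k => π.survival_eq G k H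

open Classical in
theorem ectFrom_eq (H : G.History) :
    π.ectFrom G H = 1 + ∑ σ : G.Profile,
      if σ ∈ G.W then 0 else π.profileProb G H σ * π.ectFrom G (H ++ [σ]) := by
  simp only [ectFrom_eq_tsum_survival]
  rw [tsum_eq_zero_add' ENNReal.summable]
  congr 1
  simp only [survival]
  rw [Summable.tsum_finsetSum fun _ _ => ENNReal.summable]
  refine Finset.sum_congr rfl fun σ _ => ?_
  split_ifs <;> simp [ENNReal.tsum_mul_left]

theorem one_le_ectFrom (H : G.History) : 1 ≤ π.ectFrom G H := by
  rw [ectFrom_eq]; exact le_self_add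

open Classical in
-- The expected time is the least solution of its recursion, so any supersolution dominates it.
-- Induction on the horizon bounds the partial sums of survival probabilities; almost sure
-- termination need not be known beforehand.
theorem ectFrom_le_of_potential (f : G.History → ℝ≥0∞)
    (hf : ∀ H, 1 + ∑ σ : G.Profile,
      (if σ ∈ G.W then 0 else π.profileProb G H σ * f (H ++ [σ])) ≤ f H) (H : G.History) :
    π.ectFrom G H ≤ f H := by
  rw [ectFrom_eq_tsum_survival, ENNReal.tsum_eq_iSup_nat]
  refine iSup_le fun N => ?_
  induction N generalizing H with
  | zero => simp
  | succ N ih =>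
    refine le_trans ?_ (hf H)
    rw [Finset.sum_range_succ', add_comm]
    refine add_le_add le_rfl ?_
    simp only [survival]
    rw [Finset.sum_comm]
    refine Finset.sum_le_sum fun σ _ => ?_
    split_ifs
    · simp
    · rw [← Finset.mul_sum]
      gcongr
      exact ih _

variable {π G} {G' : WLCGame}

theorem IsStructural.survival_direct (hπ : π.IsStructural) (e : DirectRenaming G G') (k : ℕ)
    (H : G.History) :
    π.survival G k H = π.survival G' k (H.map e.mapProfile) := by
  classical
  induction k generalizing H with
  | zero => rfl
  | succ k ih =>
    rw [survival, survival]
    refine Fintype.sum_equiv (e.e₁.prodCongr e.e₂) _ _ fun σ => ?_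
    have hw : (e.e₁.prodCongr e.e₂) σ ∈ G'.W ↔ σ ∈ G.W := (e.win_iff σ.1 σ.2).symm
    simp only [hw]
    rw [ih, List.map_append, profileProb, profileProb, (hπ.direct G G' e H _ rfl).1,
      (hπ.direct G G' e H _ rfl).2]
    rfl

theorem IsStructural.survival_swap (hπ : π.IsStructural) (e : SwapRenaming G G') (k : ℕ)
    (H : G.History) :
    π.survival G k H = π.survival G' k (H.map e.mapProfile) := by
  classical
  induction k generalizing H with
  | zero => rfl
  | succ k ih =>
    rw [survival, survival]
    refine Fintype.sum_equiv ((Equiv.prodComm _ _).trans (e.e₂.prodCongr e.e₁)) _ _ fun σ => ?_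
    have hw : ((Equiv.prodComm _ _).trans (e.e₂.prodCongr e.e₁)) σ ∈ G'.W ↔ σ ∈ G.W :=
      (e.win_iff σ.1 σ.2).symm
    simp only [hw]
    rw [ih, List.map_append, profileProb, profileProb, (hπ.swap G G' e H _ rfl).1,
      (hπ.swap G G' e H _ rfl).2, mul_comm (π.second G' _ _)]
    rfl

/-- Survival probabilities are transported along renamings round by round. This is what allows the
uniqueness claim to be stated up to renaming. -/
theorem IsStructural.ect_eq_of_isRenamingOf (hπ : π.IsStructural) (h : G.IsRenamingOf G') :
    π.ect G = π.ect G' := by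
  unfold ect
  rw [ectFrom_eq_tsum_survival, ectFrom_eq_tsum_survival]
  obtain ⟨⟨e⟩⟩ | ⟨⟨e⟩⟩ := h
  · exact tsum_congr fun k => hπ.survival_direct e k []
  · exact tsum_congr fun k => hπ.survival_swap e k []

end Protocol

namespace WLCGame

theorem IsRenamingOf.isOptimalECT_iff {G G' : WLCGame} (h : G.IsRenamingOf G') (r : ℝ≥0∞) :
    G.IsOptimalECT r ↔ G'.IsOptimalECT r := by
  have : {t | ∃ π : Protocol, π.IsStructural ∧ π.ect G = t} =
      {t | ∃ π : Protocol, π.IsStructural ∧ π.ect G' = t} := by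
    ext t
    constructor <;> rintro ⟨π, hπ, rfl⟩
    · exact ⟨π, hπ, (hπ.ect_eq_of_isRenamingOf h).symm⟩
    · exact ⟨π, hπ, hπ.ect_eq_of_isRenamingOf h⟩
  rw [IsOptimalECT, IsOptimalECT, this]

end WLCGame

/-! ### Structural protocols from one-player strategies -/

namespace PMF

/-- The fair mixture of two distributions. -/
def fairMix {α : Type*} [Fintype α] (p q : PMF α) : PMF α :=
  PMF.ofFintype (fun a => 2⁻¹ * p a + 2⁻¹ * q a) (by
    rw [Finset.sum_add_distrib, ← Finset.mul_sum, ← Finset.mul_sum, p.sum_eq_one, q.sum_eq_one]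
    simp [ENNReal.inv_two_add_inv_two])

theorem fairMix_apply {α : Type*} [Fintype α] (p q : PMF α) (a : α) :
    fairMix p q a = 2⁻¹ * p a + 2⁻¹ * q a := rfl

theorem uniformOfFinset_equiv {α β : Type*} (e : α ≃ β) {s : Finset α} {t : Finset β}
    (hs : s.Nonempty) (ht : t.Nonempty) (h : ∀ a, a ∈ s ↔ e a ∈ t) (a : α) :
    uniformOfFinset s hs a = uniformOfFinset t ht (e a) := by
  classical
  have hst : t = s.map e.toEmbedding := by
    ext b
    rw [Finset.mem_map_equiv, h, e.apply_symm_apply]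
  have hc : t.card = s.card := by rw [hst, Finset.card_map]
  rw [uniformOfFinset_apply, uniformOfFinset_apply, hc]
  simp only [h]

end PMF

namespace WLCGame

/-- The game with the player roles exchanged. -/
abbrev swap (G : WLCGame) : WLCGame where
  C₁ := G.C₂
  C₂ := G.C₁
  W := {σ | (σ.2, σ.1) ∈ G.W}
  not_losing₁ := G.not_losing₂
  not_losing₂ := G.not_losing₁

/-- A renaming as a renaming of the games with exchanged roles. -/
def DirectRenaming.swap {G G' : WLCGame} (e : DirectRenaming G G') :
    DirectRenaming G.swap G'.swap :=
  ⟨e.e₂, e.e₁, fun a b => e.win_iff b a⟩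

/-- A role-exchanging renaming as a role-preserving one into the game with exchanged roles. -/
def SwapRenaming.toSwapRight {G G' : WLCGame} (e : SwapRenaming G G') :
    DirectRenaming G G'.swap :=
  ⟨e.e₁, e.e₂, fun a b => e.win_iff a b⟩

/-- A role-exchanging renaming as a role-preserving one from the game with exchanged roles. -/
def SwapRenaming.toSwapLeft {G G' : WLCGame} (e : SwapRenaming G G') :
    DirectRenaming G.swap G' :=
  ⟨e.e₂, e.e₁, fun a b => e.win_iff b a⟩

end WLCGame


/-- A strategy for the first player that respects role-preserving renamings of stages. -/
structure Strategy where
  play : ∀ G : WLCGame, G.History → PMF G.C₁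
  invariant : ∀ (G G' : WLCGame) (e : DirectRenaming G G') (H : G.History) (a : G.C₁),
    play G H a = play G' (H.map e.mapProfile) (e.e₁ a)

namespace Strategy

/-- The protocol in which each player follows the strategy as if being the first player. -/
def protocol (s : Strategy) : Protocol where
  first := s.play
  second := fun G H => s.play G.swap (H.map fun σ => (σ.2, σ.1))

/-- Exchanging roles twice gives back the same game by definition, so a role-exchanging renaming is
a role-preserving one to or from an exchanged game, and invariance under the latter suffices. -/
theorem isStructural (s : Strategy) : s.protocol.IsStructural where
  direct := by
    rintro G G' e H _ rfl
    refine ⟨s.invariant G G' e H, fun b => ?_⟩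
    refine (s.invariant _ _ e.swap _ b).trans ?_
    simp only [protocol, List.map_map]
    rfl
  swap := by
    rintro G G' e H _ rfl
    refine ⟨fun a => ?_, fun b => ?_⟩
    · refine (s.invariant _ _ e.toSwapRight _ a).trans ?_
      simp only [protocol, List.map_map]
      rfl
    · refine (s.invariant _ _ e.toSwapLeft _ b).trans ?_
      simp only [protocol, List.map_map]
      rfl

end Strategy

namespace WLCGame

open Classical in
/-- The uniform distribution on the first player's winning replies to a choice of the second. -/
def reply (G : WLCGame) (b : G.C₂) : PMF G.C₁ :=
  PMF.uniformOfFinset (Finset.univ.filter fun a => (a, b) ∈ G.W)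
    (let ⟨a, ha⟩ := G.not_losing₂ b; ⟨a, by simpa using ha⟩)

theorem DirectRenaming.reply_eq {G G' : WLCGame} (e : DirectRenaming G G') (b : G.C₂) (a : G.C₁) :
    G.reply b a = G'.reply (e.e₂ b) (e.e₁ a) :=
  PMF.uniformOfFinset_equiv e.e₁ _ _ (fun a => by simpa using e.win_iff a b) a

theorem reply_eq_zero {G : WLCGame} {a : G.C₁} {b : G.C₂} (h : (a, b) ∉ G.W) :
    G.reply b a = 0 := by
  simp [reply, h]

end WLCGame

/-! ### Openings: one ranked first move, then repeating or replying -/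

/-- A first move and a ranking of choices, both compatible with role-preserving renamings. -/
structure Opening where
  start : ∀ G : WLCGame, PMF G.C₁
  rank : ∀ G : WLCGame, G.C₁ → ℕ
  start_eq : ∀ (G G' : WLCGame) (e : DirectRenaming G G') (a : G.C₁),
    start G a = start G' (e.e₁ a)
  rank_eq : ∀ (G G' : WLCGame) (e : DirectRenaming G G') (a : G.C₁),
    rank G a = rank G' (e.e₁ a)

namespace Opening

variable (o : Opening)

/-- The continuation of an opening: relative to the first profile, the player whose choice ranked
higher repeats it and the other one moves to a winning reply; on equal ranks each player tosses
a fair coin between repeating and replying. -/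
def play (G : WLCGame) : G.History → PMF G.C₁
  | [] => o.start G
  | σ :: _ =>
    if o.rank G.swap σ.2 < o.rank G σ.1 then PMF.pure σ.1
    else if o.rank G σ.1 < o.rank G.swap σ.2 then G.reply σ.2
    else PMF.fairMix (PMF.pure σ.1) (G.reply σ.2)

/-- The strategy given by an opening. -/
def strategy : Strategy where
  play := o.play
  invariant := by
    classical
    rintro G G' e (_ | ⟨σ, t⟩) a
    · exact o.start_eq G G' e a
    · have h₁ := o.rank_eq G G' e σ.1
      have h₂ : o.rank G.swap σ.2 = o.rank G'.swap (e.e₂ σ.2) := o.rank_eq _ _ e.swap σ.2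
      have h₃ : PMF.pure σ.1 a = PMF.pure (e.e₁ σ.1) (e.e₁ a) := by
        simp [PMF.pure_apply]
      simp only [play, List.map_cons, DirectRenaming.mapProfile, ← h₁, ← h₂]
      split_ifs
      · exact h₃
      · exact e.reply_eq _ _
      · rw [PMF.fairMix_apply, PMF.fairMix_apply, h₃, e.reply_eq]

/-- The potential of a nonempty history with the given first profile. -/
def cost (G : WLCGame) (σ : G.Profile) : ℝ≥0∞ :=
  if o.rank G σ.1 = o.rank G.swap σ.2 then 2 else 1

open Classical in
-- The supersolution inequality after the first round. If the ranks differ, one player stays and the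
-- other replies, which wins at once. If they agree, each round wins with probability at least 1/2,
-- and 1 + 2/2 = 2.
theorem loss_cons_le (G : WLCGame) (σ : G.Profile) (t : G.History) :
    1 + ∑ τ : G.Profile, (if τ ∈ G.W then 0 else
      o.strategy.protocol.profileProb G (σ :: t) τ * o.cost G σ) ≤ o.cost G σ := by
  set P := o.strategy.protocol.profileProb G (σ :: t) with hP
  have hsum : ∑ τ : G.Profile, (if τ ∈ G.W then P τ else 0) +
      ∑ τ : G.Profile, (if τ ∈ G.W then 0 else P τ) = 1 := by
    rw [← o.strategy.protocol.sum_profileProb G (σ :: t), ← Finset.sum_add_distrib]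
    refine Finset.sum_congr rfl fun τ _ => ?_
    split_ifs <;> simp [hP]
  have hmul : ∑ τ : G.Profile, (if τ ∈ G.W then 0 else P τ * o.cost G σ) =
      (∑ τ : G.Profile, (if τ ∈ G.W then 0 else P τ)) * o.cost G σ := by
    rw [Finset.sum_mul]
    refine Finset.sum_congr rfl fun τ _ => ?_
    split_ifs <;> simp
  have hPτ : ∀ τ, P τ = o.play G (σ :: t) τ.1 *
      o.play G.swap ((σ.2, σ.1) :: t.map fun σ => (σ.2, σ.1)) τ.2 := fun τ => rfl
  have hr₁ : ∀ τ : G.Profile, τ ∉ G.W → PMF.pure σ.1 τ.1 * G.swap.reply σ.1 τ.2 = 0 := by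
    intro τ hτ
    by_cases h : τ.1 = σ.1
    · have h0 : G.swap.reply σ.1 τ.2 = 0 := reply_eq_zero (G := G.swap) (by rw [← h]; exact hτ)
      rw [h0, mul_zero]
    · simp [PMF.pure_apply, h]
  have hr₂ : ∀ τ : G.Profile, τ ∉ G.W → G.reply σ.2 τ.1 * PMF.pure (α := G.swap.C₁) σ.2 τ.2 = 0 := by
    intro τ hτ
    by_cases h : τ.2 = σ.2
    · rw [reply_eq_zero (by rw [← h]; exact hτ), zero_mul]
    · have h0 : PMF.pure (α := G.swap.C₁) σ.2 τ.2 = 0 := by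
        rw [PMF.pure_apply]; exact if_neg h
      rw [h0, mul_zero]
  have hss : ∀ a : G.C₁, o.rank G.swap.swap a = o.rank G a := fun _ => rfl
  have hw : ∀ (p : PMF G.C₁) (q : PMF G.C₂), (∀ τ : G.Profile, τ ∉ G.W → p τ.1 * q τ.2 = 0) →
      ∑ τ : G.Profile, (if τ ∈ G.W then p τ.1 * q τ.2 else 0) = 1 := by
    intro p q h
    rw [← PMF.sum_prod_eq_one p q]
    refine Finset.sum_congr rfl fun τ _ => ?_
    split_ifs with hτ
    · rfl
    · exact (h τ hτ).symm
  rw [hmul]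
  rcases lt_trichotomy (o.rank G σ.1) (o.rank G.swap σ.2) with hlt | heq | hgt
  · have hlose : ∑ τ : G.Profile, (if τ ∈ G.W then 0 else P τ) = 0 := by
      refine Finset.sum_eq_zero fun τ _ => ?_
      split_ifs with hτ
      · rfl
      · rw [hPτ, play, play]
        simp only [hss, hlt, if_true, not_lt_of_gt hlt, if_false]
        exact hr₂ τ hτ
    rw [hlose, cost, if_neg hlt.ne]; simp
  · have hwin : 2⁻¹ ≤ ∑ τ : G.Profile, (if τ ∈ G.W then P τ else 0) := by
      -- Of the four coin outcomes, the two in which exactly one player moves always win, each with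
      -- weight 1/4. The other two are discarded.
      have h4 : (2⁻¹ : ℝ≥0∞) = 2⁻¹ * 2⁻¹ * 1 + 2⁻¹ * 2⁻¹ * 1 := by
        rw [mul_one, ← mul_add, ENNReal.inv_two_add_inv_two, mul_one]
      rw [h4]
      nth_rw 1 [← hw (PMF.pure σ.1) (G.swap.reply σ.1) hr₁]
      rw [← hw (G.reply σ.2) (PMF.pure (α := G.swap.C₁) σ.2) hr₂]
      rw [Finset.mul_sum, Finset.mul_sum, ← Finset.sum_add_distrib]
      refine Finset.sum_le_sum fun τ _ => ?_
      split_ifs with hτ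
      · rw [hPτ, play, play]
        simp only [hss, heq, lt_irrefl, if_false]
        rw [PMF.fairMix_apply]
        change _ ≤ _ * PMF.fairMix (PMF.pure (α := G.swap.C₁) σ.2) (G.swap.reply σ.1) τ.2
        rw [PMF.fairMix_apply]
        set x := PMF.pure σ.1 τ.1
        set y := G.reply σ.2 τ.1
        set z := PMF.pure (α := G.swap.C₁) σ.2 τ.2
        set w := G.swap.reply σ.1 τ.2
        change 2⁻¹ * 2⁻¹ * (x * w) + 2⁻¹ * 2⁻¹ * (y * z) ≤ _
        calc _ ≤ 2⁻¹ * 2⁻¹ * (x * w) + 2⁻¹ * 2⁻¹ * (y * z) +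
              (2⁻¹ * 2⁻¹ * (x * z) + 2⁻¹ * 2⁻¹ * (y * w)) := le_self_add
          _ = _ := by ring
      · simp
    have hlose : ∑ τ : G.Profile, (if τ ∈ G.W then 0 else P τ) ≤ 2⁻¹ := by
      have h := add_le_add_left hwin (∑ τ : G.Profile, (if τ ∈ G.W then 0 else P τ))
      rw [hsum, ← ENNReal.inv_two_add_inv_two] at h
      exact (ENNReal.add_le_add_iff_left (by simp)).1 h
    rw [cost, if_pos heq]
    calc _ ≤ 1 + 2⁻¹ * (2 : ℝ≥0∞) := by gcongr
      _ = 2 := by rw [ENNReal.inv_mul_cancel (by simp) (by simp)]; norm_num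
  · have hlose : ∑ τ : G.Profile, (if τ ∈ G.W then 0 else P τ) = 0 := by
      refine Finset.sum_eq_zero fun τ _ => ?_
      split_ifs with hτ
      · rfl
      · rw [hPτ, play, play]
        simp only [hss, hgt, if_true, not_lt_of_gt hgt, if_false]
        exact hr₁ τ hτ
    rw [hlose, cost, if_neg hgt.ne']; simp

open Classical in
theorem ect_le (G : WLCGame) :
    o.strategy.protocol.ect G ≤ 1 + ∑ τ : G.Profile, (if τ ∈ G.W then 0 else
      o.start G τ.1 * o.start G.swap τ.2 * o.cost G τ) := by
  let f : G.History → ℝ≥0∞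
    | [] => 1 + ∑ τ : G.Profile, (if τ ∈ G.W then 0 else
        o.start G τ.1 * o.start G.swap τ.2 * o.cost G τ)
    | σ :: _ => o.cost G σ
  refine Protocol.ectFrom_le_of_potential _ G f ?_ []
  rintro (_ | ⟨σ, t⟩)
  · exact le_rfl
  · exact o.loss_cons_le G σ t

open Classical in
/-- The bound `ect_le` in real numbers. -/
theorem ect_le_ofReal (G : WLCGame) :
    o.strategy.protocol.ect G ≤ ENNReal.ofReal (1 + ∑ τ : G.Profile, (if τ ∈ G.W then 0 else
      (o.start G τ.1).toReal * (o.start G.swap τ.2).toReal *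
        if o.rank G τ.1 = o.rank G.swap τ.2 then 2 else 1)) := by
  refine (o.ect_le G).trans_eq ?_
  have hnn : ∀ τ : G.Profile, (0 : ℝ) ≤ (if τ ∈ G.W then 0 else
      (o.start G τ.1).toReal * (o.start G.swap τ.2).toReal *
        if o.rank G τ.1 = o.rank G.swap τ.2 then 2 else 1) := by
    intro τ
    split_ifs <;> positivity
  rw [ENNReal.ofReal_add zero_le_one (Finset.sum_nonneg fun τ _ => hnn τ), ENNReal.ofReal_one,
    ENNReal.ofReal_sum_of_nonneg fun τ _ => hnn τ]
  congr 1
  refine Finset.sum_congr rfl fun τ _ => ?_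
  split_ifs with h₁ h₂
  · simp
  · rw [ENNReal.ofReal_mul (by positivity), ENNReal.ofReal_mul (by positivity),
      ENNReal.ofReal_toReal (PMF.apply_ne_top _ _), ENNReal.ofReal_toReal (PMF.apply_ne_top _ _),
      cost, if_pos h₂]
    simp
  · rw [ENNReal.ofReal_mul (by positivity), ENNReal.ofReal_mul (by positivity),
      ENNReal.ofReal_toReal (PMF.apply_ne_top _ _), ENNReal.ofReal_toReal (PMF.apply_ne_top _ _),
      cost, if_neg h₂]
    simp

end Opening

/-! ### Mirrored histories and the lower bound for the choice matching game -/

namespace WLCGame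

variable {m : ℕ}

/-- A permutation of the choices as a renaming of the choice matching game. -/
def CM.direct [NeZero m] (g : Equiv.Perm (Fin m)) : DirectRenaming (CM m) (CM m) :=
  ⟨g, g, fun _ _ => g.injective.eq_iff.symm⟩

/-- A permutation of the choices as a role-exchanging renaming of the choice matching game. -/
def CM.exchange [NeZero m] (g : Equiv.Perm (Fin m)) : SwapRenaming (CM m) (CM m) :=
  ⟨g, g, fun _ _ => eq_comm.trans g.injective.eq_iff.symm⟩

/-- The involution `f` exchanges the two choices of each profile of the history, and each profile
consists of distinct choices. -/
structure Mirrors (f : Equiv.Perm (Fin m)) (H : List (Fin m × Fin m)) : Prop where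
  involutive : ∀ x, f (f x) = x
  map_fst : ∀ σ ∈ H, f σ.1 = σ.2
  ne : ∀ σ ∈ H, σ.1 ≠ σ.2

variable {f : Equiv.Perm (Fin m)} {H : List (Fin m × Fin m)}

theorem Mirrors.append_singleton (hf : Mirrors f H) {x : Fin m} (hx : f x ≠ x) :
    Mirrors f (H ++ [(x, f x)]) where
  involutive := hf.involutive
  map_fst := by
    intro σ hσ
    rcases List.mem_append.1 hσ with h | h
    · exact hf.map_fst σ h
    · rw [List.mem_singleton.1 h]
  ne := by
    intro σ hσ
    rcases List.mem_append.1 hσ with h | h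
    · exact hf.ne σ h
    · rw [List.mem_singleton.1 h]; exact hx.symm

theorem Mirrors.fst_moved (hf : Mirrors f H) {σ : Fin m × Fin m} (hσ : σ ∈ H) : f σ.1 ≠ σ.1 :=
  fun h => hf.ne σ hσ (h.symm.trans (hf.map_fst σ hσ))

theorem Mirrors.snd_moved (hf : Mirrors f H) {σ : Fin m × Fin m} (hσ : σ ∈ H) : f σ.2 ≠ σ.2 := by
  rw [← hf.map_fst σ hσ, hf.involutive]
  exact (hf.fst_moved hσ).symm

/-- A losing pair of fixed choices is disjoint from the support of `f` and hence from the history,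
so its transposition can be added to the involution. -/
theorem Mirrors.mul_swap (hf : Mirrors f H) {x z : Fin m} (hx : f x = x) (hz : f z = z)
    (hxz : x ≠ z) : Mirrors (f * Equiv.swap x z) (H ++ [(x, z)]) where
  involutive := by
    intro y
    simp only [Equiv.Perm.mul_apply]
    rcases eq_or_ne y x with rfl | hyx
    · simp [hx, hz]
    rcases eq_or_ne y z with rfl | hyz
    · simp [hx, hz]
    have h₁ : f y ≠ x := fun h => hyx (by rw [← hf.involutive y, h, hx])
    have h₂ : f y ≠ z := fun h => hyz (by rw [← hf.involutive y, h, hz])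
    rw [Equiv.swap_apply_of_ne_of_ne hyx hyz, Equiv.swap_apply_of_ne_of_ne h₁ h₂, hf.involutive]
  map_fst := by
    intro σ hσ
    rcases List.mem_append.1 hσ with h | h
    · have h₁ : σ.1 ≠ x := by rintro rfl; exact hf.fst_moved h hx
      have h₂ : σ.1 ≠ z := by rintro rfl; exact hf.fst_moved h hz
      rw [Equiv.Perm.mul_apply, Equiv.swap_apply_of_ne_of_ne h₁ h₂, hf.map_fst σ h]
    · rw [List.mem_singleton.1 h]; simp [hz]
  ne := by
    intro σ hσ
    rcases List.mem_append.1 hσ with h | h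
    · exact hf.ne σ h
    · rw [List.mem_singleton.1 h]; exact hxz

/-- The choices fixed by a permutation. -/
def fixed (f : Equiv.Perm (Fin m)) : Finset (Fin m) := Finset.univ.filter fun x => f x = x

theorem mem_fixed {x : Fin m} : x ∈ fixed f ↔ f x = x := by simp [fixed]

theorem card_fixed_mul_swap {x z : Fin m} (hx : f x = x) (hz : f z = z)
    (hxz : x ≠ z) : (fixed (f * Equiv.swap x z)).card = (fixed f).card - 2 := by
  have h : fixed (f * Equiv.swap x z) = ((fixed f).erase x).erase z := by
    ext y
    simp only [Finset.mem_erase, mem_fixed, Equiv.Perm.mul_apply]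
    rcases eq_or_ne y x with rfl | hyx
    · simp [hz, hxz.symm]
    rcases eq_or_ne y z with rfl | hyz
    · simp [hx, hxz]
    rw [Equiv.swap_apply_of_ne_of_ne hyx hyz]
    simp [hyx, hyz]
  rw [h, Finset.card_erase_of_mem, Finset.card_erase_of_mem (mem_fixed.2 hx)]
  · omega
  · exact Finset.mem_erase.2 ⟨hxz.symm, mem_fixed.2 hz⟩

end WLCGame

namespace Protocol.IsStructural

variable {m : ℕ} [NeZero m] {π : Protocol} {f : Equiv.Perm (Fin m)} {H : (CM m).History}

/-- Exchanging the players along `f` maps each past profile `(a, f a)` to itself, so it is a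
symmetry of the stage. -/
theorem second_eq_first (hπ : π.IsStructural) (hf : Mirrors f H) (x : Fin m) :
    π.second (CM m) H (f x) = π.first (CM m) H x := by
  refine ((hπ.swap (CM m) (CM m) (CM.exchange f) H H ?_).1 x).symm
  refine (List.map_congr_left fun σ hσ => ?_).trans (List.map_id H)
  have h := hf.map_fst σ hσ
  refine Prod.ext ?_ h
  change f σ.2 = σ.1
  rw [← h, hf.involutive]

/-- Fixed choices do not occur in the history, so transposing two of them is a symmetry of the
stage. -/
theorem first_eq_first (hπ : π.IsStructural) (hf : Mirrors f H) {x z : Fin m} (hx : f x = x)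
    (hz : f z = z) : π.first (CM m) H x = π.first (CM m) H z := by
  have h := (hπ.direct (CM m) (CM m) (CM.direct (Equiv.swap x z)) H H ?_).1 x
  · rw [h]
    change π.first (CM m) H (Equiv.swap x z x) = _
    rw [Equiv.swap_apply_left]
  · refine (List.map_congr_left fun σ hσ => ?_).trans (List.map_id H)
    have h₁ := hf.fst_moved hσ
    have h₂ := hf.snd_moved hσ
    refine Prod.ext ?_ ?_
    · change Equiv.swap x z σ.1 = σ.1
      exact Equiv.swap_apply_of_ne_of_ne (fun h => h₁ (by rw [h, hx])) fun h => h₁ (by rw [h, hz])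
    · change Equiv.swap x z σ.2 = σ.2
      exact Equiv.swap_apply_of_ne_of_ne (fun h => h₂ (by rw [h, hx])) fun h => h₂ (by rw [h, hz])

end Protocol.IsStructural

/-- The quadratic form that bounds the expected coordination time after a mirrored history: the
second player's distribution is the image of `p` under `f`, repeating a moved pair costs `v` and
a new pair of fixed choices costs `w`. -/
theorem sum_mirror_eq {m : ℕ} (f : Equiv.Perm (Fin m)) (hf : ∀ x, f (f x) = x)
    (p : Fin m → ℝ) (v w : ℝ) :
    ∑ x, ∑ z, (if x = f z then 0 else p x * p z *
      (if x = z then v else if f x = x ∧ f z = z then w else 1)) =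
    (∑ x, p x) ^ 2 - ∑ x, p x * p (f x) + (v - 1) * ∑ x, (if f x = x then 0 else p x ^ 2) +
      (w - 1) * ((∑ x, if f x = x then p x else 0) ^ 2 - ∑ x, if f x = x then p x ^ 2 else 0) := by
  have h1 : (∑ x, p x) ^ 2 = ∑ x, ∑ z, p x * p z := by
    rw [← Finset.sum_mul_sum, pow_two]
  have h2 : ∑ x, p x * p (f x) = ∑ x, ∑ z, if x = f z then p x * p z else 0 := by
    refine Finset.sum_congr rfl fun x _ => ?_
    rw [Finset.sum_eq_single (f x)]
    · simp [hf]
    · intro z _ hz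
      rw [if_neg]
      rintro rfl
      exact hz (hf z).symm
    · simp
  have h3 : ∑ x, (if f x = x then 0 else p x ^ 2) =
      ∑ x, ∑ z, if x = z then (if f x = x then 0 else p x * p z) else 0 := by
    refine Finset.sum_congr rfl fun x _ => ?_
    simp [pow_two]
  have h4 : (∑ x, if f x = x then p x else 0) ^ 2 =
      ∑ x, ∑ z, if f x = x ∧ f z = z then p x * p z else 0 := by
    rw [pow_two, Finset.sum_mul_sum]
    refine Finset.sum_congr rfl fun x _ => Finset.sum_congr rfl fun z _ => ?_
    by_cases hx : f x = x <;> by_cases hz : f z = z <;> simp [hx, hz]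
  have h5 : ∑ x, (if f x = x then p x ^ 2 else 0) =
      ∑ x, ∑ z, if x = z then (if f x = x then p x * p z else 0) else 0 := by
    refine Finset.sum_congr rfl fun x _ => ?_
    simp [pow_two]
  rw [h1, h2, h3, h4, h5]
  simp only [Finset.mul_sum, ← Finset.sum_sub_distrib, ← Finset.sum_add_distrib]
  refine Finset.sum_congr rfl fun x _ => Finset.sum_congr rfl fun z _ => ?_
  by_cases hxz : x = z
  · subst hxz
    by_cases hx : f x = x
    · simp [hx]
    · simp [hx, Ne.symm hx]; ring
  · by_cases hx : f x = x <;> by_cases hz : f z = z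
    · have : x ≠ f z := by rwa [hz]
      simp [hx, hz, hxz]; ring
    · have : x ≠ f z := by rintro rfl; exact hz (by rw [← hx, hf])
      simp [hx, hz, hxz, this]
    · have : x ≠ f z := by rwa [hz]
      simp [hx, hz, hxz]
    · by_cases h : x = f z <;> simp [hx, hz, hxz, h]

/-- Let q be `p` restricted to moved choices, A = ∑ q(x)² the probability of repeating a mirrored
pair and B = ∑ q(x)q(f x) that of winning on moved choices. Since B ≤ A, each chance of winning
there costs at least as large a chance of a loop. Since also A + B ≤ (∑ q)² = (1 - u)², B is at most
half of (1 - u)². The fixed choices share the mass u equally, so they win with probability u²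
divided by their number; if there are none, u = 0 and Lean's `1 / 0 = 0` is harmless. -/
theorem mirror_bound {m : ℕ} (f : Equiv.Perm (Fin m)) (hf : ∀ x, f (f x) = x)
    (p : Fin m → ℝ) (h0 : ∀ x, 0 ≤ p x) (hp : ∑ x, p x = 1) {v : ℝ} (hv : 1 ≤ v) (w : ℝ)
    (hfix : ∀ x z, f x = x → f z = z → p x = p z) :
    ∃ B u : ℝ, 0 ≤ B ∧ 2 * B ≤ (1 - u) ^ 2 ∧ 0 ≤ u ∧ u ≤ 1 ∧
      ((Finset.univ.filter fun x => f x = x).card = 0 → u = 0) ∧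
      ((∀ x, f x = x) → u = 1) ∧
      2 - (2 - v) * B - u ^ 2 * (1 - w * (1 - 1 / (Finset.univ.filter fun x => f x = x).card)) ≤
      1 + ∑ x, ∑ z, (if x = f z then 0 else p x * p z *
        (if x = z then v else if f x = x ∧ f z = z then w else 1)) := by
  set U := Finset.univ.filter fun x => f x = x with hU
  set u := ∑ x, if f x = x then p x else 0 with hu
  set q : Fin m → ℝ := fun x => if f x = x then 0 else p x with hq
  have hq0 : ∀ x, 0 ≤ q x := fun x => by simp only [hq]; split_ifs <;> simp [h0]
  have hqsum : ∑ x, q x = 1 - u := by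
    rw [← hp, hu, ← Finset.sum_sub_distrib]
    refine Finset.sum_congr rfl fun x _ => ?_
    simp only [hq]; split_ifs <;> simp
  have hu0 : 0 ≤ u := Finset.sum_nonneg fun x _ => by split_ifs <;> simp [h0]
  have hu1 : u ≤ 1 := by
    have := Finset.sum_nonneg fun x (_ : x ∈ Finset.univ) => hq0 x
    linarith
  have huU : u = ∑ x ∈ U, p x := by rw [hu, hU, Finset.sum_filter]
  have hC : ∑ x, (if f x = x then p x ^ 2 else 0) = u ^ 2 / U.card := by
    rw [← Finset.sum_filter, ← hU]
    rcases U.eq_empty_or_nonempty with h | ⟨y, hy⟩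
    · simp [h]
    · have hy' : f y = y := by simpa [hU] using hy
      have hc : ∀ x ∈ U, p x = p y := fun x hx => hfix x y (by simpa [hU] using hx) hy'
      have hU0 : (U.card : ℝ) ≠ 0 := by
        have := Finset.card_pos.2 ⟨y, hy⟩
        positivity
      rw [huU, Finset.sum_congr rfl hc, Finset.sum_congr rfl fun x hx => by rw [hc x hx]]
      simp only [Finset.sum_const, nsmul_eq_mul]
      field_simp
  set A := ∑ x, q x ^ 2 with hA
  set B := ∑ x, q x * q (f x) with hB
  have hff : ∀ x, f (f x) = f x ↔ f x = x := fun x => f.injective.eq_iff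
  have hA' : ∑ x, (if f x = x then 0 else p x ^ 2) = A := by
    refine Finset.sum_congr rfl fun x _ => ?_
    simp only [hq]; split_ifs <;> simp
  have hB' : ∑ x, p x * p (f x) = B + u ^ 2 / U.card := by
    rw [← hC, hB, ← Finset.sum_add_distrib]
    refine Finset.sum_congr rfl fun x _ => ?_
    simp only [hq, hff]
    split_ifs with h
    · rw [h]; ring
    · ring
  have hqf : ∑ x, q (f x) ^ 2 = A := Equiv.sum_comp f fun x => q x ^ 2
  have hBA : B ≤ A := by
    have h : 0 ≤ ∑ x, (q x - q (f x)) ^ 2 := Finset.sum_nonneg fun x _ => sq_nonneg _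
    have h' : ∑ x, (q x - q (f x)) ^ 2 = ∑ x, q x ^ 2 + ∑ x, q (f x) ^ 2 - 2 * B := by
      rw [hB, Finset.mul_sum, ← Finset.sum_add_distrib, ← Finset.sum_sub_distrib]
      exact Finset.sum_congr rfl fun x _ => by ring
    rw [h', hqf] at h
    linarith
  have hAB : A + B ≤ (1 - u) ^ 2 := by
    rw [pow_two, ← hqsum, Finset.sum_mul, hA, hB, ← Finset.sum_add_distrib]
    refine Finset.sum_le_sum fun x _ => ?_
    rw [pow_two, ← mul_add]
    refine mul_le_mul_of_nonneg_left ?_ (hq0 x)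
    by_cases h : f x = x
    · have : q x = 0 := by simp [hq, h]
      rw [h, this, add_zero]
      exact Finset.sum_nonneg fun x _ => hq0 x
    · rw [← Finset.sum_pair (Ne.symm h)]
      exact Finset.sum_le_sum_of_subset_of_nonneg (Finset.subset_univ _) fun x _ _ => hq0 x
  have hB0 : 0 ≤ B := Finset.sum_nonneg fun x _ => mul_nonneg (hq0 _) (hq0 _)
  refine ⟨B, u, hB0, by linarith, hu0, hu1, ?_, fun h => by simp [hu, h, hp], ?_⟩
  · intro h
    rw [huU, Finset.card_eq_zero.1 h, Finset.sum_empty]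
  · rw [sum_mirror_eq f hf p, hp, one_pow, hA', hB', hC]
    have : (v - 1) * B ≤ (v - 1) * A := mul_le_mul_of_nonneg_left hBA (by linarith)
    rw [show u ^ 2 * (1 - w * (1 - 1 / (U.card : ℝ))) =
      u ^ 2 - w * (u ^ 2 - u ^ 2 / U.card) by ring]
    linarith

/-- The optimal expected coordination time of the choice matching game after a losing symmetric
history, as a function of the number of untouched choices. -/
def residualTime (n : ℕ) : ℝ := if n = 1 then 1 else if n = 3 then 5 / 3 else 2

theorem one_le_residualTime (n : ℕ) : 1 ≤ residualTime n := by
  unfold residualTime; split_ifs <;> norm_num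

theorem residualTime_le_two (n : ℕ) : residualTime n ≤ 2 := by
  unfold residualTime; split_ifs <;> norm_num

/-- The claimed values satisfy the recursive lower bound. For n ≠ 3 it suffices that `residualTime
(n - 2) * (1 - 1 / n) ≥ 1`, so that playing fixed choices does not help. For n = 3 this product is
2/3, and the bound 5/3 follows from B + u² ≤ 1. -/
theorem residualTime_step {n : ℕ} (hn : n ≠ 1) {B u : ℝ} (hBu : 2 * B ≤ (1 - u) ^ 2)
    (hu0 : 0 ≤ u) (hu1 : u ≤ 1) (hz : n = 0 → u = 0) :
    residualTime n ≤ 2 - (2 - residualTime n) * B -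
      u ^ 2 * (1 - residualTime (n - 2) * (1 - 1 / n)) := by
  rcases Nat.eq_zero_or_pos n with rfl | hpos
  · simp [hz rfl, residualTime]
  by_cases h3 : n = 3
  · subst h3
    norm_num [residualTime]
    nlinarith
  · have hc : residualTime n = 2 := by simp [residualTime, hn, h3]
    rw [hc]
    have hn2 : (2 : ℝ) ≤ n := by exact_mod_cast (by omega : 2 ≤ n)
    have key : 1 ≤ residualTime (n - 2) * (1 - 1 / n) := by
      rw [show (1 : ℝ) - 1 / n = (n - 1) / n by field_simp, ← mul_div_assoc,
        le_div_iff₀ (by linarith), one_mul]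
      by_cases h5 : n = 5
      · subst h5; norm_num [residualTime]
      · have : residualTime (n - 2) = 2 := by
          unfold residualTime
          rw [if_neg (by omega), if_neg (by omega)]
        rw [this]; linarith
    nlinarith [sq_nonneg u]

namespace Protocol.IsStructural

variable {m : ℕ} [NeZero m] {π : Protocol} {f : Equiv.Perm (Fin m)} {H : (CM m).History}

/-- One round of the recursion after a mirrored history: `v` bounds the time after a repeated pair,
`w` that after a new pair of fixed choices, and every other loss is charged the trivial single
round. -/
theorem le_ectFrom_of_mirrors (hπ : π.IsStructural) (hf : Mirrors f H) {v w : ℝ} (hv : 1 ≤ v)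
    (hvH : ∀ x, f x ≠ x → ENNReal.ofReal v ≤ π.ectFrom (CM m) (H ++ [((x, f x) : (CM m).Profile)]))
    (hwH : ∀ x z, f x = x → f z = z → x ≠ z →
      ENNReal.ofReal w ≤ π.ectFrom (CM m) (H ++ [((x, z) : (CM m).Profile)])) :
    ∃ B u : ℝ, 0 ≤ B ∧ 2 * B ≤ (1 - u) ^ 2 ∧ 0 ≤ u ∧ u ≤ 1 ∧ ((fixed f).card = 0 → u = 0) ∧
      ((∀ x, f x = x) → u = 1) ∧
      ENNReal.ofReal (2 - (2 - v) * B - u ^ 2 * (1 - w * (1 - 1 / (fixed f).card))) ≤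
        π.ectFrom (CM m) H := by
  classical
  set p : Fin m → ℝ := fun x => (π.first (CM m) H x).toReal with hp
  have hpn : ∀ x, ENNReal.ofReal (p x) = π.first (CM m) H x := fun x =>
    ENNReal.ofReal_toReal (PMF.apply_ne_top _ _)
  -- `max w 0` keeps the summands nonnegative, so that `ENNReal.ofReal` commutes with the sum.
  obtain ⟨B, u, hB0, hB, hu0, hu1, hz, hone, hle⟩ := mirror_bound f hf.involutive p
    (fun _ => ENNReal.toReal_nonneg) (PMF.sum_toReal_eq_one (π.first (CM m) H)) hv (max w 0)
    (fun x z hx hz => by simp only [hp, hπ.first_eq_first hf hx hz])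
  refine ⟨B, u, hB0, hB, hu0, hu1, hz, hone, ?_⟩
  have hmax : 2 - (2 - v) * B - u ^ 2 * (1 - w * (1 - 1 / (fixed f).card)) ≤
      2 - (2 - v) * B - u ^ 2 * (1 - max w 0 * (1 - 1 / (fixed f).card)) := by
    have h1 : (1 : ℝ) / (fixed f).card ≤ 1 := by
      rcases Nat.eq_zero_or_pos (fixed f).card with h | h
      · simp [h]
      · rw [div_le_one (by positivity)]; exact_mod_cast h
    have h2 := le_max_left w 0
    have h3 : w * (1 - 1 / (fixed f).card) ≤ max w 0 * (1 - 1 / (fixed f).card) :=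
      mul_le_mul_of_nonneg_right h2 (by linarith)
    have := mul_le_mul_of_nonneg_left h3 (sq_nonneg u)
    linarith
  refine (ENNReal.ofReal_le_ofReal (hmax.trans hle)).trans ?_
  have hg : ∀ x z, (0 : ℝ) ≤
      (if x = z then v else if f x = x ∧ f z = z then max w 0 else 1) := by
    intro x z
    split_ifs
    · linarith
    · exact le_max_right _ _
    · exact zero_le_one
  have hnn : ∀ x z, (0 : ℝ) ≤ (if x = f z then 0 else p x * p z *
      (if x = z then v else if f x = x ∧ f z = z then max w 0 else 1)) := by
    intro x z
    by_cases h : x = f z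
    · simp [h]
    · rw [if_neg h]
      exact mul_nonneg (mul_nonneg ENNReal.toReal_nonneg ENNReal.toReal_nonneg) (hg x z)
  rw [ENNReal.ofReal_add zero_le_one
    (Finset.sum_nonneg fun x _ => Finset.sum_nonneg fun z _ => hnn x z), ENNReal.ofReal_one,
    π.ectFrom_eq, ENNReal.ofReal_sum_of_nonneg fun x _ => Finset.sum_nonneg fun z _ => hnn x z]
  refine add_le_add le_rfl ?_
  refine le_of_le_of_eq ?_ (Fintype.sum_prod_type _).symm
  refine Finset.sum_le_sum fun x _ => ?_
  rw [ENNReal.ofReal_sum_of_nonneg fun z _ => hnn x z]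
  -- The second player's choice is written as `f z`, which has probability `p z`.
  refine le_of_le_of_eq ?_ (Equiv.sum_comp f fun y => (if ((x, y) : (CM m).Profile) ∈ (CM m).W then
    0 else π.profileProb (CM m) H (x, y) * π.ectFrom (CM m) (H ++ [((x, y) : (CM m).Profile)])))
  refine Finset.sum_le_sum fun z _ => ?_
  have hmem : ((x, f z) : (CM m).Profile) ∈ (CM m).W ↔ x = f z := Iff.rfl
  simp only [hmem]
  by_cases h : x = f z
  · simp [h]
  rw [if_neg h, if_neg h, ENNReal.ofReal_mul
    (mul_nonneg ENNReal.toReal_nonneg ENNReal.toReal_nonneg),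
    ENNReal.ofReal_mul ENNReal.toReal_nonneg, hpn, hpn]
  have hprob : π.profileProb (CM m) H (x, f z) = π.first (CM m) H x * π.first (CM m) H z := by
    rw [profileProb, ← hπ.second_eq_first hf z]
  rw [hprob]
  refine mul_le_mul_right ?_ _
  split_ifs with h₁ h₂
  · subst h₁
    exact hvH x (Ne.symm h)
  · rcases le_total w 0 with h0 | h0
    · rw [max_eq_right h0]; simp
    · rw [max_eq_left h0, h₂.2]
      exact hwH x z h₂.1 h₂.2 h₁
  · rw [ENNReal.ofReal_one]
    exact π.one_le_ectFrom _ _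

theorem residualTime_le_ectFrom (hπ : π.IsStructural) (hf : Mirrors f H) :
    ENNReal.ofReal (residualTime (fixed f).card) ≤ π.ectFrom (CM m) H := by
  induction hn : (fixed f).card using Nat.strong_induction_on generalizing f H with
  | _ n ih =>
  by_cases h1 : n = 1
  · simpa [residualTime, h1] using π.one_le_ectFrom (CM m) H
  have hc1 := one_le_residualTime n
  have hc2 := residualTime_le_two n
  -- A new pair of fixed choices lowers `n` by 2 and is covered by `ih`, but a repeated pair leaves
  -- `n` unchanged. So the bound is bootstrapped from the trivial value 1: each round multiplies the
  -- deficit by at most B ≤ 1/2, and the limit removes it.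
  have iter : ∀ (j : ℕ) (H : (CM m).History), Mirrors f H →
      ENNReal.ofReal (residualTime n - (residualTime n - 1) * (1 / 2) ^ j) ≤
        π.ectFrom (CM m) H := by
    intro j
    induction j with
    | zero => intro H _; simpa using π.one_le_ectFrom (CM m) H
    | succ j ihj =>
      intro H hf
      set ε : ℝ := (1 / 2) ^ j with hε
      have hε0 : 0 ≤ ε := by positivity
      have hε1 : ε ≤ 1 := pow_le_one₀ (by norm_num) (by norm_num)
      have hcε : 0 ≤ (residualTime n - 1) * ε := mul_nonneg (by linarith) hε0
      have hcε' : (residualTime n - 1) * ε ≤ residualTime n - 1 :=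
        mul_le_of_le_one_right (by linarith) hε1
      obtain ⟨B, u, hB0, hB, hu0, hu1, hz, hone, hle⟩ := hπ.le_ectFrom_of_mirrors hf
        (v := residualTime n - (residualTime n - 1) * ε) (w := residualTime (n - 2)) (by linarith)
        (fun x hx => ihj _ (hf.append_singleton hx))
        (fun x z hx hz hxz => by
          have hcard := card_fixed_mul_swap hx hz hxz
          have hpos : 0 < (fixed f).card := Finset.card_pos.2 ⟨x, mem_fixed.2 hx⟩
          have hcard' : (fixed (f * Equiv.swap x z)).card = n - 2 := by rw [hcard, hn]
          exact ih _ (by omega) (hf.mul_swap hx hz hxz) hcard')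
      refine le_trans (ENNReal.ofReal_le_ofReal ?_) hle
      rw [hn] at hz ⊢
      have hstep := residualTime_step h1 hB hu0 hu1 hz
      have hB' : 2 * B ≤ 1 := by nlinarith
      have := mul_le_mul_of_nonneg_left hB' hcε
      rw [pow_succ, ← hε]
      linarith
  have hlim : Filter.Tendsto
      (fun j : ℕ => ENNReal.ofReal (residualTime n - (residualTime n - 1) * (1 / 2) ^ j))
      Filter.atTop (nhds (ENNReal.ofReal (residualTime n))) := by
    refine ENNReal.tendsto_ofReal ?_
    have := (tendsto_pow_atTop_nhds_zero_of_lt_one (r := (1 / 2 : ℝ)) (by norm_num)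
      (by norm_num)).const_mul (residualTime n - 1) |>.const_sub (residualTime n)
    simpa using this
  exact le_of_tendsto' hlim fun j => iter j H hf

/-- The lower bound on expected coordination times in the choice matching game. -/
theorem le_ect_CM (hπ : π.IsStructural) :
    ENNReal.ofReal (1 + (1 - 1 / m) * residualTime (m - 2)) ≤ π.ect (CM m) := by
  have hf : Mirrors (1 : Equiv.Perm (Fin m)) [] := ⟨fun _ => rfl, by simp, by simp⟩
  have hcard : (fixed (1 : Equiv.Perm (Fin m))).card = m := by simp [fixed]
  obtain ⟨B, u, hB0, hB, -, -, -, hone, hle⟩ := hπ.le_ectFrom_of_mirrors (v := 1)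
    (w := residualTime (m - 2)) hf le_rfl
    (fun x hx => absurd rfl hx)
    (fun x z hx hz hxz => by
      have := hπ.residualTime_le_ectFrom (hf.mul_swap hx hz hxz)
      rwa [card_fixed_mul_swap hx hz hxz, hcard] at this)
  refine le_trans (ENNReal.ofReal_le_ofReal ?_) hle
  -- Before the first round every choice is fixed, so only the term for new pairs survives.
  have hu : u = 1 := hone fun _ => rfl
  have hB' : B = 0 := by rw [hu] at hB; linarith
  rw [hcard, hu, hB']
  linarith

end Protocol.IsStructural

/-! ### Counting winning pairs -/

namespace WLCGame

variable (G : WLCGame)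

open Classical in
/-- The indicator function of the winning relation. -/
def edge (a : G.C₁) (b : G.C₂) : ℕ := if (a, b) ∈ G.W then 1 else 0

/-- The number of winning profiles that contain the given choice of the first player. -/
def degree (a : G.C₁) : ℕ := ∑ b, G.edge a b

/-- The number of winning profiles. -/
def edges : ℕ := ∑ a, ∑ b, G.edge a b

variable {G}

theorem DirectRenaming.edge_eq {G' : WLCGame} (e : DirectRenaming G G') (a : G.C₁) (b : G.C₂) :
    G.edge a b = G'.edge (e.e₁ a) (e.e₂ b) := by
  classical
  simp only [edge]
  exact if_congr (e.win_iff a b) rfl rfl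

theorem DirectRenaming.degree_eq {G' : WLCGame} (e : DirectRenaming G G') (a : G.C₁) :
    G.degree a = G'.degree (e.e₁ a) :=
  Fintype.sum_equiv e.e₂ _ _ fun b => e.edge_eq a b

theorem edge_eq_one_iff {a : G.C₁} {b : G.C₂} : G.edge a b = 1 ↔ (a, b) ∈ G.W := by
  simp [edge]

theorem one_le_degree (a : G.C₁) : 1 ≤ G.degree a := by
  obtain ⟨b, hb⟩ := G.not_losing₁ a
  rw [← edge_eq_one_iff.2 hb]
  exact Finset.single_le_sum (f := G.edge a) (fun _ _ => Nat.zero_le _) (Finset.mem_univ b)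

theorem edges_swap : G.swap.edges = G.edges := Finset.sum_comm

theorem card_le_edges : Fintype.card G.C₁ ≤ G.edges := by
  rw [Fintype.card_eq_sum_ones]
  exact Finset.sum_le_sum fun a _ => one_le_degree a

/-- With only `m` winning pairs all degrees on the first side are 1, so the winning relation is the
graph of a function. It is onto because the second player has no losing choice, hence bijective. -/
theorem isRenamingOf_CM_of_edges {m : ℕ} [NeZero m] (h₁ : Fintype.card G.C₁ = m)
    (h₂ : Fintype.card G.C₂ = m) (hE : G.edges = m) : G.IsRenamingOf (CM m) := by
  classical
  have hdeg : ∀ a, G.degree a = 1 := by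
    have h : ∑ a : G.C₁, 1 = ∑ a, G.degree a := by
      rw [← Fintype.card_eq_sum_ones, h₁]; exact hE.symm
    intro a
    exact ((Finset.sum_eq_sum_iff_of_le fun a _ => one_le_degree a).1 h a (Finset.mem_univ a)).symm
  choose g hg using G.not_losing₁
  have hW : ∀ a b, (a, b) ∈ G.W ↔ g a = b := by
    intro a b
    refine ⟨fun h => ?_, fun h => h ▸ hg a⟩
    by_contra hne
    have h2 : ∑ x ∈ {g a, b}, G.edge a x ≤ G.degree a :=
      Finset.sum_le_sum_of_subset (Finset.subset_univ ({g a, b} : Finset G.C₂))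
    rw [Finset.sum_pair hne, edge_eq_one_iff.2 h, edge_eq_one_iff.2 (hg a), hdeg] at h2
    omega
  have hsurj : Function.Surjective g := fun b => by
    obtain ⟨a, ha⟩ := G.not_losing₂ b
    exact ⟨a, (hW a b).1 ha⟩
  have hbij : Function.Bijective g :=
    (Fintype.bijective_iff_surjective_and_card g).2 ⟨hsurj, h₁.trans h₂.symm⟩
  let e : G.C₁ ≃ Fin m := Fintype.equivFinOfCardEq h₁
  let g' : G.C₁ ≃ G.C₂ := Equiv.ofBijective g hbij
  refine Or.inl ⟨⟨e, g'.symm.trans e, fun a b => ?_⟩⟩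
  rw [hW]
  change g' a = b ↔ e a = e (g'.symm b)
  rw [e.injective.eq_iff, Equiv.eq_symm_apply]

theorem edges_CM (m : ℕ) [NeZero m] : (CM m).edges = m := by
  have h : ∀ a b : Fin m, (CM m).edge a b = if a = b then 1 else 0 := fun a b => by
    classical
    exact if_congr Iff.rfl rfl rfl
  change ∑ a : Fin m, ∑ b : Fin m, (CM m).edge a b = m
  simp [h]

end WLCGame

/-! ### Wait-or-move, and tie-breaking by size and degree -/

namespace Opening

/-- Uniform first choices and constant ranks: the wait-or-move protocol. -/
def uniform : Opening where
  start G := PMF.uniformOfFintype G.C₁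
  rank _ _ := 0
  start_eq G G' e a := by
    rw [PMF.uniformOfFintype_apply, PMF.uniformOfFintype_apply, Fintype.card_congr e.e₁]
  rank_eq _ _ _ _ := rfl

theorem uniform_ect_le (G : WLCGame) :
    uniform.strategy.protocol.ect G ≤ ENNReal.ofReal
      (3 - 2 * G.edges / (Fintype.card G.C₁ * Fintype.card G.C₂)) := by
  classical
  refine (uniform.ect_le_ofReal G).trans (ENNReal.ofReal_le_ofReal (le_of_eq ?_))
  have h₁ : (Fintype.card G.C₁ : ℝ) ≠ 0 := by
    have := Fintype.card_pos (α := G.C₁); positivity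
  have h₂ : (Fintype.card G.C₂ : ℝ) ≠ 0 := by
    have := Fintype.card_pos (α := G.C₂); positivity
  have hterm : ∀ τ : G.Profile, (if τ ∈ G.W then 0 else
      (uniform.start G τ.1).toReal * (uniform.start G.swap τ.2).toReal *
        if uniform.rank G τ.1 = uniform.rank G.swap τ.2 then (2 : ℝ) else 1) =
      2 / (Fintype.card G.C₁ * Fintype.card G.C₂) * (1 - (G.edge τ.1 τ.2 : ℝ)) := by
    intro τ
    have hs₁ : (uniform.start G τ.1).toReal = (Fintype.card G.C₁ : ℝ)⁻¹ := by
      simp [uniform]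
    have hs₂ : (uniform.start G.swap τ.2).toReal = (Fintype.card G.C₂ : ℝ)⁻¹ := by
      simp [uniform]
    have hr : uniform.rank G τ.1 = uniform.rank G.swap τ.2 := rfl
    rw [hs₁, hs₂, if_pos hr]
    by_cases h : τ ∈ G.W
    · simp [edge, h]
    · simp [edge, h]; ring
  rw [Finset.sum_congr rfl fun τ _ => hterm τ, ← Finset.mul_sum, Finset.sum_sub_distrib,
    Fintype.sum_prod_type (f := fun τ : G.Profile => (G.edge τ.1 τ.2 : ℝ))]
  simp only [Finset.sum_const, Finset.card_univ, Fintype.card_prod, nsmul_eq_mul, mul_one,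
    Nat.cast_mul]
  have hE : ∑ a, ∑ b, (G.edge a b : ℝ) = G.edges := by simp [edges]
  rw [hE]
  field_simp
  ring

open Classical in
/-- The choices that occur in at least two winning profiles. -/
def hubs (G : WLCGame) : Finset G.C₁ := Finset.univ.filter fun a => 2 ≤ G.degree a

open Classical in
/-- The choices that occur in only one winning profile. -/
def leaves (G : WLCGame) : Finset G.C₁ := Finset.univ.filter fun a => ¬ 2 ≤ G.degree a

theorem mem_hubs {G : WLCGame} {a : G.C₁} : a ∈ hubs G ↔ 2 ≤ G.degree a := by simp [hubs]

theorem mem_leaves {G : WLCGame} {a : G.C₁} : a ∈ leaves G ↔ ¬ 2 ≤ G.degree a := by simp [leaves]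

open Classical in
/-- The first choice is a hub or a leaf with equal probability; players with more choices and
hubs rank higher. -/
def hubLeaf : Opening where
  start G :=
    if h : (hubs G).Nonempty ∧ (leaves G).Nonempty then
      PMF.fairMix (PMF.uniformOfFinset _ h.1) (PMF.uniformOfFinset _ h.2)
    else PMF.uniformOfFintype G.C₁
  rank G a := 2 * Fintype.card G.C₁ + if 2 ≤ G.degree a then 1 else 0
  start_eq G G' e a := by
    have hh : ∀ x, x ∈ hubs G ↔ e.e₁ x ∈ hubs G' := fun x => by simp [hubs, ← e.degree_eq]
    have hl : ∀ x, x ∈ leaves G ↔ e.e₁ x ∈ leaves G' := fun x => by simp [leaves, ← e.degree_eq]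
    have hn : ((hubs G).Nonempty ∧ (leaves G).Nonempty) ↔
        ((hubs G').Nonempty ∧ (leaves G').Nonempty) := by
      constructor
      · rintro ⟨⟨x, hx⟩, y, hy⟩
        exact ⟨⟨_, (hh x).1 hx⟩, _, (hl y).1 hy⟩
      · rintro ⟨⟨x, hx⟩, y, hy⟩
        exact ⟨⟨e.e₁.symm x, (hh _).2 (by simpa)⟩, e.e₁.symm y, (hl _).2 (by simpa)⟩
    by_cases h : (hubs G).Nonempty ∧ (leaves G).Nonempty
    · rw [dif_pos h, dif_pos (hn.1 h), PMF.fairMix_apply, PMF.fairMix_apply,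
        PMF.uniformOfFinset_equiv e.e₁ h.1 (hn.1 h).1 hh,
        PMF.uniformOfFinset_equiv e.e₁ h.2 (hn.1 h).2 hl]
    · rw [dif_neg h, dif_neg (fun h' => h (hn.2 h')), PMF.uniformOfFintype_apply,
        PMF.uniformOfFintype_apply, Fintype.card_congr e.e₁]
  rank_eq G G' e a := by rw [Fintype.card_congr e.e₁, e.degree_eq]

/-- The size term in the rank is doubled, so unequal sizes outweigh the hub bonus. Ranks then always
differ, and coordination is certain by the second round. -/
theorem hubLeaf_ect_le_two {G : WLCGame} (h : Fintype.card G.C₁ ≠ Fintype.card G.C₂) :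
    hubLeaf.strategy.protocol.ect G ≤ 2 := by
  classical
  refine (hubLeaf.ect_le G).trans ?_
  rw [← one_add_one_eq_two]
  refine add_le_add le_rfl ?_
  rw [← PMF.sum_prod_eq_one (hubLeaf.start G) (hubLeaf.start G.swap)]
  refine Finset.sum_le_sum fun τ _ => ?_
  have hne : hubLeaf.rank G τ.1 ≠ hubLeaf.rank G.swap τ.2 := by
    simp only [hubLeaf]
    split_ifs <;> omega
  rw [cost, if_neg hne, mul_one]
  split_ifs
  · exact zero_le
  · exact le_rfl

theorem hubLeaf_start_hub {G : WLCGame} (hh : (hubs G).Nonempty) (hl : (leaves G).Nonempty)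
    {a : G.C₁} (ha : 2 ≤ G.degree a) :
    (hubLeaf.start G a).toReal = 1 / (2 * (hubs G).card) := by
  have h : a ∈ hubs G := mem_hubs.2 ha
  have h' : a ∉ leaves G := fun h => mem_leaves.1 h ha
  simp only [hubLeaf]
  rw [dif_pos ⟨hh, hl⟩, PMF.fairMix_apply, PMF.uniformOfFinset_apply_of_mem hh h,
    PMF.uniformOfFinset_apply_of_notMem hl h']
  simp [mul_comm]

theorem hubLeaf_start_leaf {G : WLCGame} (hh : (hubs G).Nonempty) (hl : (leaves G).Nonempty)
    {a : G.C₁} (ha : ¬ 2 ≤ G.degree a) :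
    (hubLeaf.start G a).toReal = 1 / (2 * (leaves G).card) := by
  have h : a ∈ leaves G := mem_leaves.2 ha
  have h' : a ∉ hubs G := fun h => ha (mem_hubs.1 h)
  simp only [hubLeaf]
  rw [dif_pos ⟨hh, hl⟩, PMF.fairMix_apply, PMF.uniformOfFinset_apply_of_mem hl h,
    PMF.uniformOfFinset_apply_of_notMem hh h']
  simp [mul_comm]

theorem sum_hubs_add_sum_leaves {M : Type*} [AddCommMonoid M] {G : WLCGame} (F : G.C₁ → M) :
    ∑ a ∈ hubs G, F a + ∑ a ∈ leaves G, F a = ∑ a, F a :=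
  Finset.sum_filter_add_sum_filter_not _ _ _

theorem sum_leaves_degree {G : WLCGame} : ∑ a ∈ leaves G, G.degree a = (leaves G).card := by
  rw [Finset.card_eq_sum_ones]
  refine Finset.sum_congr rfl fun a ha => ?_
  have h : ¬ 2 ≤ G.degree a := mem_leaves.1 ha
  have := one_le_degree a
  omega

theorem two_mul_card_hubs_le {G : WLCGame} : 2 * (hubs G).card ≤ ∑ a ∈ hubs G, G.degree a := by
  rw [mul_comm, ← smul_eq_mul]
  exact Finset.card_nsmul_le_sum _ _ _ fun a ha => mem_hubs.1 ha

theorem card_hubs_add_card_leaves {G : WLCGame} :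
    (hubs G).card + (leaves G).card = Fintype.card G.C₁ :=
  Finset.card_filter_add_card_filter_not _

theorem hubs_nonempty {G : WLCGame} (h : Fintype.card G.C₁ < G.edges) : (hubs G).Nonempty := by
  by_contra h0
  rw [Finset.not_nonempty_iff_eq_empty] at h0
  have h1 := sum_hubs_add_sum_leaves G.degree
  have h2 := card_hubs_add_card_leaves (G := G)
  rw [sum_leaves_degree, h0] at h1
  rw [h0] at h2
  simp only [Finset.sum_empty, Finset.card_empty, zero_add] at h1 h2
  have h3 : ∑ a, G.degree a = G.edges := rfl
  omega

theorem leaves_nonempty {G : WLCGame} (h : G.edges < 2 * Fintype.card G.C₁) :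
    (leaves G).Nonempty := by
  by_contra h0
  rw [Finset.not_nonempty_iff_eq_empty] at h0
  have h1 := sum_hubs_add_sum_leaves G.degree
  have h2 := card_hubs_add_card_leaves (G := G)
  have h3 : ∑ a, G.degree a = G.edges := rfl
  have h4 := two_mul_card_hubs_le (G := G)
  rw [h0] at h1 h2
  simp only [Finset.sum_empty, Finset.card_empty, add_zero] at h1 h2
  omega

/-- The numerical estimate for the two kinds of choices in games with five choices per player:
`k, l` and `k', l'` count hubs and leaves and `x, y, z, w` the edges of each kind. -/
theorem hubLeaf_estimate {k l k' l' x y z w : ℕ} (hl : k + l = 5) (hl' : k' + l' = 5)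
    (hk : 1 ≤ k) (hk' : 1 ≤ k') (h1 : z + w = l) (h2 : y + w = l')
    (h3 : 2 * k ≤ x + y) (h4 : 2 * k' ≤ x + z) (h5 : x + y + (z + w) ≤ 8) :
    1 + ((1 / (2 * k : ℝ)) * (1 / (2 * k')) * 2 * (k * k' - x) +
      (1 / (2 * k : ℝ)) * (1 / (2 * l')) * 1 * (k * l' - y) +
      ((1 / (2 * l : ℝ)) * (1 / (2 * k')) * 1 * (l * k' - z) +
      (1 / (2 * l : ℝ)) * (1 / (2 * l')) * 2 * (l * l' - w))) < 7 / 3 := by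
  -- Counting edges gives 2k + (5 - k) ≤ 8, and likewise for `k'`. Without first-round wins the left
  -- side would be 5/2; in each of the nine cases linear constraints show that these wins save more
  -- than 1/6.
  have hk3 : k ≤ 3 := by omega
  have hk3' : k' ≤ 3 := by omega
  have h1' : (z : ℝ) + w = l := by exact_mod_cast h1
  have h2' : (y : ℝ) + w = l' := by exact_mod_cast h2
  have h3' : 2 * (k : ℝ) ≤ x + y := by exact_mod_cast h3
  have h4' : 2 * (k' : ℝ) ≤ x + z := by exact_mod_cast h4
  have hx : (0 : ℝ) ≤ x := by positivity
  have hy : (0 : ℝ) ≤ y := by positivity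
  have hz : (0 : ℝ) ≤ z := by positivity
  have hw : (0 : ℝ) ≤ w := by positivity
  clear h1 h2 h3 h4 h5
  obtain rfl : l = 5 - k := by omega
  obtain rfl : l' = 5 - k' := by omega
  interval_cases k <;> interval_cases k' <;> norm_num at h1' h2' h3' h4' ⊢ <;> linarith

theorem hubLeaf_ect_lt {G : WLCGame} (h₁ : Fintype.card G.C₁ = 5) (h₂ : Fintype.card G.C₂ = 5)
    (hE : 5 < G.edges) (hE' : G.edges ≤ 8) :
    hubLeaf.strategy.protocol.ect G < ENNReal.ofReal (7 / 3) := by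
  classical
  refine (hubLeaf.ect_le_ofReal G).trans_lt ((ENNReal.ofReal_lt_ofReal_iff (by norm_num)).2 ?_)
  have hE₂ := edges_swap (G := G)
  have hA : (hubs G).Nonempty := hubs_nonempty (by omega)
  have hB : (leaves G).Nonempty := leaves_nonempty (by omega)
  have hA' : (hubs G.swap).Nonempty := hubs_nonempty (by change Fintype.card G.C₂ < _; omega)
  have hB' : (leaves G.swap).Nonempty := leaves_nonempty (by change _ < 2 * Fintype.card G.C₂; omega)
  -- On each product of hubs or leaves the starting weights and the continuation cost are constant,
  -- so only the number of edges in the block matters.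
  have block : ∀ (S : Finset G.C₁) (T : Finset G.C₂) (s t c : ℝ),
      (∀ a ∈ S, ∀ b ∈ T, (hubLeaf.start G a).toReal = s ∧ (hubLeaf.start G.swap b).toReal = t ∧
        (if hubLeaf.rank G a = hubLeaf.rank G.swap b then (2 : ℝ) else 1) = c) →
      ∑ a ∈ S, ∑ b ∈ T, (if (a, b) ∈ G.W then 0 else
        (hubLeaf.start G a).toReal * (hubLeaf.start G.swap b).toReal *
        (if hubLeaf.rank G a = hubLeaf.rank G.swap b then (2 : ℝ) else 1)) =
      s * t * c * (S.card * T.card - (∑ a ∈ S, ∑ b ∈ T, G.edge a b : ℕ)) := by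
    intro S T s t c h
    have : ∀ a ∈ S, ∀ b ∈ T, (if (a, b) ∈ G.W then 0 else
        (hubLeaf.start G a).toReal * (hubLeaf.start G.swap b).toReal *
        (if hubLeaf.rank G a = hubLeaf.rank G.swap b then (2 : ℝ) else 1)) =
        s * t * c * (1 - G.edge a b) := by
      intro a ha b hb
      obtain ⟨r₁, r₂, r₃⟩ := h a ha b hb
      rw [r₁, r₂, r₃, edge]
      split_ifs <;> simp
    rw [Finset.sum_congr rfl fun a ha => Finset.sum_congr rfl fun b hb => this a ha b hb]
    simp only [← Finset.mul_sum, Finset.sum_sub_distrib, Finset.sum_const, nsmul_eq_mul, mul_one]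
    push_cast
    rfl
  have hrank : ∀ (a : G.C₁) (b : G.C₂), hubLeaf.rank G a = hubLeaf.rank G.swap b ↔
      (2 ≤ G.degree a ↔ 2 ≤ G.swap.degree b) := by
    intro a b
    simp only [hubLeaf]
    rw [h₁, h₂]
    by_cases h : 2 ≤ G.degree a <;> by_cases h' : 2 ≤ G.swap.degree b <;> simp [h, h']
  rw [Fintype.sum_prod_type, ← sum_hubs_add_sum_leaves]
  simp only [← sum_hubs_add_sum_leaves (G := G.swap), Finset.sum_add_distrib]
  rw [block (hubs G) (hubs G.swap) _ _ 2 fun a ha b hb =>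
      ⟨hubLeaf_start_hub hA hB (mem_hubs.1 ha), hubLeaf_start_hub hA' hB' (mem_hubs.1 hb),
        if_pos ((hrank a b).2 (by simp [mem_hubs.1 ha, mem_hubs.1 hb]))⟩,
    block (hubs G) (leaves G.swap) _ _ 1 fun a ha b hb =>
      ⟨hubLeaf_start_hub hA hB (mem_hubs.1 ha), hubLeaf_start_leaf hA' hB' (mem_leaves.1 hb),
        if_neg fun h => mem_leaves.1 hb (((hrank a b).1 h).1 (mem_hubs.1 ha))⟩,
    block (leaves G) (hubs G.swap) _ _ 1 fun a ha b hb =>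
      ⟨hubLeaf_start_leaf hA hB (mem_leaves.1 ha), hubLeaf_start_hub hA' hB' (mem_hubs.1 hb),
        if_neg fun h => mem_leaves.1 ha (((hrank a b).1 h).2 (mem_hubs.1 hb))⟩,
    block (leaves G) (leaves G.swap) _ _ 2 fun a ha b hb =>
      ⟨hubLeaf_start_leaf hA hB (mem_leaves.1 ha), hubLeaf_start_leaf hA' hB' (mem_leaves.1 hb),
        if_pos ((hrank a b).2 (by simp [mem_leaves.1 ha, mem_leaves.1 hb]))⟩]
  have d : ∀ S : Finset G.C₁, ∑ a ∈ S, ∑ b ∈ hubs G.swap, G.edge a b +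
      ∑ a ∈ S, ∑ b ∈ leaves G.swap, G.edge a b = ∑ a ∈ S, G.degree a := by
    intro S
    rw [← Finset.sum_add_distrib]
    exact Finset.sum_congr rfl fun a _ => sum_hubs_add_sum_leaves (G := G.swap) (G.edge a)
  have d' : ∀ T : Finset G.C₂, ∑ a ∈ hubs G, ∑ b ∈ T, G.edge a b +
      ∑ a ∈ leaves G, ∑ b ∈ T, G.edge a b = ∑ b ∈ T, G.swap.degree b := by
    intro T
    rw [sum_hubs_add_sum_leaves, Finset.sum_comm]
    rfl
  refine hubLeaf_estimate (card_hubs_add_card_leaves.trans h₁)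
    ((card_hubs_add_card_leaves (G := G.swap)).trans h₂) (Finset.card_pos.2 hA)
    (Finset.card_pos.2 hA') ((d _).trans sum_leaves_degree) ((d' _).trans sum_leaves_degree)
    (two_mul_card_hubs_le.trans_eq (d _).symm)
    (two_mul_card_hubs_le.trans_eq (d' _).symm) ?_
  rw [d, d, sum_hubs_add_sum_leaves]
  exact hE'

end Opening

/-! ### Loop avoidance in the choice matching game -/

namespace WLCGame

open Classical in
/-- The choices of the first player that neither have been played nor win against a choice that
has been played. -/
def untouched (G : WLCGame) (H : G.History) : Finset G.C₁ :=
  Finset.univ.filter fun a => ∀ σ ∈ H, a ≠ σ.1 ∧ (a, σ.2) ∉ G.W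

theorem mem_untouched {G : WLCGame} {H : G.History} {a : G.C₁} :
    a ∈ G.untouched H ↔ ∀ σ ∈ H, a ≠ σ.1 ∧ (a, σ.2) ∉ G.W := by
  simp [untouched]

theorem DirectRenaming.mem_untouched_iff {G G' : WLCGame} (e : DirectRenaming G G')
    (H : G.History) (a : G.C₁) :
    a ∈ G.untouched H ↔ e.e₁ a ∈ G'.untouched (H.map e.mapProfile) := by
  rw [mem_untouched, mem_untouched, List.forall_mem_map]
  refine forall₂_congr fun σ _ => and_congr e.e₁.injective.ne_iff.symm ?_
  exact not_congr (e.win_iff a σ.2)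

end WLCGame

open Classical in
/-- The strategy of choosing uniformly among the untouched choices: the loop avoidance protocol. -/
def Strategy.avoidLoops : Strategy where
  play G H := if h : (G.untouched H).Nonempty then PMF.uniformOfFinset _ h
    else PMF.uniformOfFintype G.C₁
  invariant G G' e H a := by
    have hn : (G.untouched H).Nonempty ↔ (G'.untouched (H.map e.mapProfile)).Nonempty := by
      constructor
      · rintro ⟨x, hx⟩
        exact ⟨_, (e.mem_untouched_iff H x).1 hx⟩
      · rintro ⟨x, hx⟩
        exact ⟨e.e₁.symm x, (e.mem_untouched_iff H _).2 (by simpa)⟩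
    by_cases h : (G.untouched H).Nonempty
    · rw [dif_pos h, dif_pos (hn.1 h)]
      exact PMF.uniformOfFinset_equiv e.e₁ _ _ (e.mem_untouched_iff H) a
    · rw [dif_neg h, dif_neg (fun h' => h (hn.2 h')), PMF.uniformOfFintype_apply,
        PMF.uniformOfFintype_apply, Fintype.card_congr e.e₁]

namespace WLCGame

variable {m : ℕ}

/-- The choices that do not occur in a history of the choice matching game. -/
def CM.free (H : List (Fin m × Fin m)) : Finset (Fin m) :=
  Finset.univ.filter fun a => ∀ σ ∈ H, a ≠ σ.1 ∧ a ≠ σ.2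

theorem CM.mem_free {H : List (Fin m × Fin m)} {a : Fin m} :
    a ∈ CM.free H ↔ ∀ σ ∈ H, a ≠ σ.1 ∧ a ≠ σ.2 := by
  simp [CM.free]

theorem CM.untouched_eq [NeZero m] (H : (CM m).History) : (CM m).untouched H = CM.free H :=
  Finset.ext fun _ => mem_untouched.trans CM.mem_free.symm

theorem CM.untouched_swap_eq [NeZero m] (H : (CM m).History) :
    (CM m).swap.untouched (H.map fun σ => (σ.2, σ.1)) = CM.free H := by
  refine Finset.ext fun a => mem_untouched.trans (Iff.trans ?_ CM.mem_free.symm)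
  rw [List.forall_mem_map]
  refine forall₂_congr fun σ _ => and_comm.trans (and_congr ?_ Iff.rfl)
  exact not_congr eq_comm

theorem CM.card_free_append {H : List (Fin m × Fin m)} {x z : Fin m} (hx : x ∈ CM.free H)
    (hz : z ∈ CM.free H) (hxz : x ≠ z) :
    (CM.free (H ++ [(x, z)])).card = (CM.free H).card - 2 := by
  have h : CM.free (H ++ [(x, z)]) = ((CM.free H).erase x).erase z := by
    ext a
    rw [Finset.mem_erase, Finset.mem_erase, CM.mem_free, CM.mem_free]
    simp only [List.forall_mem_append, List.forall_mem_singleton]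
    tauto
  rw [h, Finset.card_erase_of_mem, Finset.card_erase_of_mem hx]
  · omega
  · exact Finset.mem_erase.2 ⟨hxz.symm, hz⟩

theorem CM.avoidLoops_profileProb [NeZero m] {H : (CM m).History} (h : (CM.free H).Nonempty)
    (x z : Fin m) :
    Strategy.avoidLoops.protocol.profileProb (CM m) H (x, z) =
      if x ∈ CM.free H ∧ z ∈ CM.free H then
        ((CM.free H).card : ℝ≥0∞)⁻¹ * ((CM.free H).card : ℝ≥0∞)⁻¹ else 0 := by
  have hne₁ : ((CM m).untouched H).Nonempty := CM.untouched_eq H ▸ h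
  have hne₂ : ((CM m).swap.untouched (H.map fun σ => (σ.2, σ.1))).Nonempty :=
    CM.untouched_swap_eq H ▸ h
  have h1 : Strategy.avoidLoops.protocol.first (CM m) H x =
      if x ∈ CM.free H then ((CM.free H).card : ℝ≥0∞)⁻¹ else 0 := by
    refine (congrArg (fun p : PMF (CM m).C₁ => p x) (dif_pos hne₁)).trans ?_
    refine (PMF.uniformOfFinset_apply hne₁ x).trans ?_
    rw [CM.untouched_eq]
    by_cases hx : x ∈ CM.free H
    · exact (if_pos hx).trans (if_pos hx).symm
    · exact (if_neg hx).trans (if_neg hx).symm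
  have h2 : Strategy.avoidLoops.protocol.second (CM m) H z =
      if z ∈ CM.free H then ((CM.free H).card : ℝ≥0∞)⁻¹ else 0 := by
    refine (congrArg (fun p : PMF (CM m).C₂ => p z) (dif_pos hne₂)).trans ?_
    refine (PMF.uniformOfFinset_apply hne₂ z).trans ?_
    rw [CM.untouched_swap_eq]
    by_cases hz : z ∈ CM.free H
    · exact (if_pos hz).trans (if_pos hz).symm
    · exact (if_neg hz).trans (if_neg hz).symm
  rw [Protocol.profileProb, h1, h2]
  by_cases h3 : x ∈ CM.free H <;> by_cases h4 : z ∈ CM.free H <;> simp [h3, h4]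

/-- An upper bound on the expected coordination time of loop avoidance with an odd number of
untouched choices. -/
def avoidLoopsTime (n : ℕ) : ℝ≥0∞ :=
  if n = 1 then 1 else if n = 3 then ENNReal.ofReal (5 / 3)
  else if n = 5 then ENNReal.ofReal (7 / 3) else ⊤

/-- Two draws from n free choices differ with probability (n² - n)/n²: 1 + (6/9)·1 = 5/3 and 1 +
(20/25)·(5/3) = 7/3. Other sizes are not needed and carry the bound `⊤`. -/
theorem avoidLoopsTime_step {n : ℕ} (hn : n ≠ 0) :
    1 + ((n * n - n : ℕ) : ℝ≥0∞) * ((n : ℝ≥0∞)⁻¹ * (n : ℝ≥0∞)⁻¹ * avoidLoopsTime (n - 2)) ≤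
      avoidLoopsTime n := by
  have key : ∀ (k l : ℕ) (t s : ℝ), 0 < k → 0 ≤ t → 1 + l * ((1 / k) * (1 / k) * t) ≤ s →
      1 + (l : ℝ≥0∞) * ((k : ℝ≥0∞)⁻¹ * (k : ℝ≥0∞)⁻¹ * ENNReal.ofReal t) ≤ ENNReal.ofReal s := by
    intro k l t s hk ht h
    refine le_trans (le_of_eq ?_) (ENNReal.ofReal_le_ofReal h)
    have hk' : (0 : ℝ) < k := by exact_mod_cast hk
    rw [ENNReal.ofReal_add zero_le_one (by positivity), ENNReal.ofReal_mul (by positivity),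
      ENNReal.ofReal_mul (by positivity), ENNReal.ofReal_mul (by positivity), one_div,
      ENNReal.ofReal_inv_of_pos hk', ENNReal.ofReal_natCast, ENNReal.ofReal_natCast,
      ENNReal.ofReal_one]
  by_cases h1 : n = 1
  -- Here `1 - 2 = 0` and `avoidLoopsTime 0 = ⊤`, but the coefficient is 0 and `0 * ⊤ = 0`.
  · simp [h1, avoidLoopsTime]
  by_cases h3 : n = 3
  · subst h3
    simpa [avoidLoopsTime] using key 3 6 1 (5 / 3) (by norm_num) (by norm_num) (by norm_num)
  by_cases h5 : n = 5
  · subst h5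
    simpa [avoidLoopsTime] using key 5 20 (5 / 3) (7 / 3) (by norm_num) (by norm_num) (by norm_num)
  · simp [avoidLoopsTime, h1, h3, h5]

theorem CM.avoidLoops_ect_le [NeZero m] :
    Strategy.avoidLoops.protocol.ect (CM m) ≤ avoidLoopsTime m := by
  classical
  let f : (CM m).History → ℝ≥0∞ := fun H => avoidLoopsTime (CM.free H).card
  have hm : (CM.free ([] : List (Fin m × Fin m))).card = m := by simp [CM.free]
  refine (Protocol.ectFrom_le_of_potential _ _ f (fun H => ?_) []).trans_eq
    (congrArg avoidLoopsTime hm)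
  change _ ≤ avoidLoopsTime (CM.free H).card
  rcases (CM.free H).eq_empty_or_nonempty with h0 | hne
  · simp [h0, avoidLoopsTime]
  refine le_trans (add_le_add le_rfl (le_of_eq ?_)) (avoidLoopsTime_step (Finset.card_pos.2 hne).ne')
  rw [← Finset.offDiag_card, ← nsmul_eq_mul, ← Finset.sum_const]
  refine (Finset.sum_subset (Finset.subset_univ (CM.free H).offDiag) ?_).symm.trans
    (Finset.sum_congr rfl ?_)
  · rintro ⟨x, z⟩ _ hσ
    by_cases hxz : x = z
    · exact if_pos hxz
    · refine (if_neg hxz).trans ?_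
      have hP := (CM.avoidLoops_profileProb hne x z).trans (if_neg fun h =>
        hσ (Finset.mem_offDiag.2 ⟨h.1, h.2, hxz⟩))
      exact (congrArg (· * f (H ++ [((x, z) : (CM m).Profile)])) hP).trans (zero_mul _)
  · rintro ⟨x, z⟩ hσ
    obtain ⟨h1, h2, h3⟩ := Finset.mem_offDiag.1 hσ
    refine (if_neg h3).trans ?_
    have hP := (CM.avoidLoops_profileProb hne x z).trans (if_pos ⟨h1, h2⟩)
    exact congrArg₂ (· * ·) hP (congrArg avoidLoopsTime (CM.card_free_append h1 h2 h3))

/-! ### Comparing the choice matching game with all other games -/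

/-- The optimal expected coordination time of the choice matching game. -/
def matchingTime (m : ℕ) : ℝ≥0∞ := ENNReal.ofReal (1 + (1 - 1 / m) * residualTime (m - 2))

theorem matchingTime_eq {m : ℕ} [NeZero m] (h3 : m ≠ 3) (h5 : m ≠ 5) :
    matchingTime m = ENNReal.ofReal (3 - 2 / m) := by
  have hm := NeZero.ne m
  rw [matchingTime, residualTime, if_neg (by omega), if_neg (by omega)]
  congr 1
  ring

theorem matchingTime_five : matchingTime 5 = ENNReal.ofReal (7 / 3) := by
  rw [matchingTime, residualTime]
  norm_num

theorem CM.exists_ect_le (m : ℕ) [NeZero m] (hm : m ≠ 3) :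
    ∃ π : Protocol, π.IsStructural ∧ π.ect (CM m) ≤ matchingTime m := by
  by_cases h5 : m = 5
  · subst h5
    refine ⟨_, Strategy.avoidLoops.isStructural, CM.avoidLoops_ect_le.trans ?_⟩
    rw [matchingTime_five]
    simp [avoidLoopsTime]
  · refine ⟨_, Opening.uniform.strategy.isStructural, (Opening.uniform_ect_le _).trans ?_⟩
    rw [matchingTime_eq hm h5, edges_CM]
    refine ENNReal.ofReal_le_ofReal (le_of_eq ?_)
    have h0 : (m : ℝ) ≠ 0 := Nat.cast_ne_zero.2 (NeZero.ne m)
    have h1 : Fintype.card (CM m).C₁ = m := Fintype.card_fin m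
    have h2 : Fintype.card (CM m).C₂ = m := Fintype.card_fin m
    rw [h1, h2]
    field_simp

theorem CM.isOptimalECT (m : ℕ) [NeZero m] (hm : m ≠ 3) :
    (CM m).IsOptimalECT (matchingTime m) := by
  obtain ⟨π, hπ, hle⟩ := CM.exists_ect_le m hm
  refine ⟨⟨π, hπ, le_antisymm hle hπ.le_ect_CM⟩, ?_⟩
  rintro _ ⟨π', hπ', rfl⟩
  exact hπ'.le_ect_CM

/-- Since no choice is losing, there are at least `m` winning pairs. Equality would force both
choice sets to have size `m` and exactly `m` winning pairs, which is the matching game. -/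
theorem card_mul_card_lt {G : WLCGame} {m : ℕ} [NeZero m] (hG : G.IsChoiceGame m)
    (hCM : ¬ G.IsRenamingOf (CM m)) :
    Fintype.card G.C₁ * Fintype.card G.C₂ < m * G.edges := by
  have hE₁ := card_le_edges (G := G)
  have hE₂ : Fintype.card G.C₂ ≤ G.edges := edges_swap (G := G) ▸ card_le_edges (G := G.swap)
  have hm := Nat.pos_of_ne_zero (NeZero.ne m)
  have hmax : max (Fintype.card G.C₁) (Fintype.card G.C₂) = m := hG
  have h₁ : Fintype.card G.C₁ ≤ m := hmax ▸ le_max_left _ _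
  have h₂ : Fintype.card G.C₂ ≤ m := hmax ▸ le_max_right _ _
  have hE : m ≤ G.edges := hmax ▸ max_le hE₁ hE₂
  rcases lt_or_eq_of_le h₁ with hlt₁ | heq₁
  · calc _ < m * m := Nat.mul_lt_mul_of_lt_of_le hlt₁ h₂ hm
      _ ≤ _ := Nat.mul_le_mul_left m hE
  rcases lt_or_eq_of_le h₂ with hlt₂ | heq₂
  · calc _ < m * m := Nat.mul_lt_mul_of_le_of_lt h₁ hlt₂ hm
      _ ≤ _ := Nat.mul_le_mul_left m hE
  · rw [heq₁, heq₂]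
    refine Nat.mul_lt_mul_of_pos_left (lt_of_le_of_ne hE fun h => ?_) hm
    exact hCM (isRenamingOf_CM_of_edges heq₁ heq₂ h.symm)

theorem exists_ect_lt {G : WLCGame} {m : ℕ} [NeZero m] (hm : m ≠ 3) (hG : G.IsChoiceGame m)
    (hCM : ¬ G.IsRenamingOf (CM m)) :
    ∃ π : Protocol, π.IsStructural ∧ π.ect G < matchingTime m := by
  have hlt := card_mul_card_lt hG hCM
  have h₁ := Fintype.card_pos (α := G.C₁)
  have h₂ := Fintype.card_pos (α := G.C₂)
  have hm0 := Nat.pos_of_ne_zero (NeZero.ne m)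
  by_cases h5 : m = 5
  · subst h5
    rw [matchingTime_five]
    by_cases hne : Fintype.card G.C₁ = Fintype.card G.C₂
    · have hmax : max (Fintype.card G.C₁) (Fintype.card G.C₂) = 5 := hG
      rw [← hne, max_self] at hmax
      rw [← hne, hmax] at hlt
      by_cases hE : G.edges ≤ 8
      · exact ⟨_, Opening.hubLeaf.strategy.isStructural,
          Opening.hubLeaf_ect_lt hmax (hne ▸ hmax) (by omega) hE⟩
      · refine ⟨_, Opening.uniform.strategy.isStructural, (Opening.uniform_ect_le G).trans_lt
          ((ENNReal.ofReal_lt_ofReal_iff (by norm_num)).2 ?_)⟩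
        have hE' : (9 : ℝ) ≤ G.edges := by exact_mod_cast (by omega : 9 ≤ G.edges)
        rw [← hne, hmax]
        norm_num
        linarith
    · refine ⟨_, Opening.hubLeaf.strategy.isStructural,
        (Opening.hubLeaf_ect_le_two hne).trans_lt ?_⟩
      rw [show (2 : ℝ≥0∞) = ENNReal.ofReal 2 by simp]
      exact (ENNReal.ofReal_lt_ofReal_iff (by norm_num)).2 (by norm_num)
  · have hm' : (1 : ℝ) ≤ m := by exact_mod_cast hm0
    have hdiv : (2 : ℝ) / m ≤ 2 := div_le_self (by norm_num) hm'
    refine ⟨_, Opening.uniform.strategy.isStructural, (Opening.uniform_ect_le G).trans_lt ?_⟩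
    rw [matchingTime_eq hm h5]
    refine (ENNReal.ofReal_lt_ofReal_iff (by linarith)).2 (sub_lt_sub_left ?_ 3)
    rw [div_lt_div_iff₀ (by positivity) (by positivity)]
    have : ((Fintype.card G.C₁ * Fintype.card G.C₂ : ℕ) : ℝ) < (m * G.edges : ℕ) := by
      exact_mod_cast hlt
    push_cast at this
    linarith

end WLCGame

end

/-- For `m ≠ 3`, the greatest optimal expected coordination time among `m`-choice games exists and
is realized by the choice matching game, and by no other `m`-choice game (up to renaming). -/
theorem mainTheorem2 (m : ℕ) [NeZero m] (hm : m ≠ 3) :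
    (WLCGame.CM m).IsChoiceGame m ∧
    ∃ r : ENNReal,
      WLCGame.IsGreatestOptimalECT {G : WLCGame | G.IsChoiceGame m} r ∧
      ∀ G : WLCGame, G.IsChoiceGame m →
        (G.IsOptimalECT r ↔ G.IsRenamingOf (WLCGame.CM m)) := by
  have hCM : (WLCGame.CM m).IsChoiceGame m :=
    (max_self _).trans (Fintype.card_fin m)
  have hopt := WLCGame.CM.isOptimalECT m hm
  refine ⟨hCM, WLCGame.matchingTime m, ⟨⟨_, hCM, hopt⟩, fun G hG => ?_⟩, fun G hG => ⟨fun h => ?_,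
    fun h => (h.isOptimalECT_iff _).2 hopt⟩⟩
  · by_cases h : G.IsRenamingOf (WLCGame.CM m)
    · obtain ⟨π, hπ, hle⟩ := WLCGame.CM.exists_ect_le m hm
      exact ⟨π, hπ, (hπ.ect_eq_of_isRenamingOf h).trans_le hle⟩
    · obtain ⟨π, hπ, hlt⟩ := WLCGame.exists_ect_lt hm hG h
      exact ⟨π, hπ, hlt.le⟩
  · by_contra hne
    obtain ⟨π, hπ, hlt⟩ := WLCGame.exists_ect_lt hm hG hne
    exact absurd (h.2 ⟨π, hπ, rfl⟩) (not_le.2 hlt)
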